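/- Let $\mathbb D=\{\lambda\in\mathbb C:|\lambda|<1\}$ and let $\rho(u,v)=\operatorname{artanh}\frac{|u-v|}{|1-\bar v u|}$ be the hyperbolic distance on $\mathbb D$. For a domain $D\subset\mathbb C^n$ let $\mathcal O(D,\mathbb D)$ be the set of holomorphic functions $D\to\mathbb D$ and let $c_D(w,z)=\sup\{\rho(F(w),F(z)):F\in\mathcal O(D,\mathbb D)\}$ be the Carathéodory pseudodistance. A set $\mathcal C\subset\mathcal O(D,\mathbb D)$ is called a universal set for the Carathéodory extremal problem on $D$ if for all $w,z\in D$ with $w\neq z$ there is an $F\in\mathcal C$ with $c_D(w,z)=\rho(F(w),F(z))$. Let $a,b>0$ be such that the triple $(a,b,1)$ satisfies the (strict) triangle inequality, that is, $a<b+1$, $b<a+1$ and $1<a+b$, and let $$D_{a,b}=\{z\in\mathbb D^2:\ |az_1+bz_2-z_1z_2|<|bz_1+az_2-1|\}.$$ Then $D_{a,b}$ is a domain (open and connected), and the following hold for the three functions $$f_1(z)=z_1,\qquad f_2(z)=z_2,\qquad f_3(z)=\frac{az_1+bz_2-z_1z_2}{bz_1+az_2-1}.$$ 1. Every universal set $\mathcal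 C$ for the Carathéodory extremal problem on $D_{a,b}$ contains $f_1,f_2,f_3$ up to automorphisms of the disc: for each $j\in\{1,2,3\}$ there is a holomorphic automorphism $\varphi$ of $\mathbb D$ such that $\varphi\circ f_j\in\mathcal C$. 2. The set $\{f_1,f_2,f_3\}$ is a universal set for the Carathéodory extremal problem on $D_{a,b}$ with exactly three elements, and every universal set for this problem has at least three elements (in particular none has two). 3. $D_{a,b}$ is not biholomorphic to the bidisc $\mathbb D^2$. -/

import Mathlib

open Set

namespace CaratheodoryUniversal

noncomputable section

/-- The open unit disc in `ℂ`. -/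
def disc : Set ℂ := Metric.ball 0 1

/-- The unit bidisc in `ℂ²`. -/
def bidisc : Set (ℂ × ℂ) := disc ×ˢ disc

/-- The hyperbolic (Poincaré) distance on the unit disc,
`ρ(u, v) = artanh (|u - v| / |1 - conj v * u|)`. -/
def hypDist (u v : ℂ) : ℝ :=
  Real.artanh (‖u - v‖ / ‖1 - (starRingEnd ℂ) v * u‖)

section General

variable {E E' : Type*} [NormedAddCommGroup E] [NormedSpace ℂ E]
  [NormedAddCommGroup E'] [NormedSpace ℂ E']

/-- The holomorphic functions from `D` to the unit disc. A function on `D` is represented by a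
function on the whole space, whose values off `D` play no role. -/
def holoToDisc (D : Set E) : Set (E → ℂ) :=
  {F | DifferentiableOn ℂ F D ∧ MapsTo F D disc}

/-- The Carathéodory pseudodistance of `D`, as a supremum in `[0, ∞]`. -/
def carDist (D : Set E) (w z : E) : ENNReal :=
  ⨆ F ∈ holoToDisc D, ENNReal.ofReal (hypDist (F w) (F z))

/-- `C` is a universal set for the Carathéodory extremal problem on `D`: a set of holomorphic
functions from `D` to the disc such that for any two distinct points of `D` some member of `C`
attains the Carathéodory pseudodistance. -/
def IsUniversalSet (D : Set E) (C : Set (E → ℂ)) : Prop :=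
  C ⊆ holoToDisc D ∧
    ∀ w ∈ D, ∀ z ∈ D, w ≠ z →
      ∃ F ∈ C, carDist D w z = ENNReal.ofReal (hypDist (F w) (F z))

/-- `f` restricts to a biholomorphic map from `D` onto `D'`. -/
def IsBiholomorphicMap (f : E → E') (D : Set E) (D' : Set E') : Prop :=
  DifferentiableOn ℂ f D ∧ MapsTo f D D' ∧
    ∃ g : E' → E, DifferentiableOn ℂ g D' ∧ MapsTo g D' D ∧ LeftInvOn g f D ∧ RightInvOn g f D'

/-- `C` contains, up to an automorphism of the unit disc, the function `f` on `D`. -/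
def ContainsUpToAut (D : Set E) (C : Set (E → ℂ)) (f : E → ℂ) : Prop :=
  ∃ φ : ℂ → ℂ, IsBiholomorphicMap φ disc disc ∧ ∃ F ∈ C, EqOn F (φ ∘ f) D

end General

/-- The numerator `a z₁ + b z₂ - z₁ z₂`. -/
def numer (a b : ℝ) (z : ℂ × ℂ) : ℂ := a * z.1 + b * z.2 - z.1 * z.2

/-- The denominator `b z₁ + a z₂ - 1`. -/
def denom (a b : ℝ) (z : ℂ × ℂ) : ℂ := b * z.1 + a * z.2 - 1

/-- The rational function `(a z₁ + b z₂ - z₁ z₂) / (b z₁ + a z₂ - 1)`. -/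
def ratFun (a b : ℝ) (z : ℂ × ℂ) : ℂ := numer a b z / denom a b z

/-- The set `D_{a,b}` of points `z` of the bidisc with
`|a z₁ + b z₂ - z₁ z₂| < |b z₁ + a z₂ - 1|`; the denominator of `ratFun a b` has no zero on it. -/
def domainD (a b : ℝ) : Set (ℂ × ℂ) :=
  {z | z ∈ bidisc ∧ ‖numer a b z‖ < ‖denom a b z‖}

end

end CaratheodoryUniversal

/-!
Let `α`, `β`, `γ` be the angles of the triangle with sides `a`, `b`, `1`, and `e₁ = exp (i α)`,
`e₂ = exp (i β)`, `e₃ = exp (i γ)`, so that `e₁ e₂ e₃ = -1`. The involutions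
`cayley e z = (e - z) / (1 - e z)` exchange the disc and the upper half-plane `H`. By the law of
sines the relation between `z₁`, `z₂` and `z₃ = ratFun a b z` becomes `x y w = -1` for
`x = cayley e₁ z₁`, `y = cayley e₂ z₂`, `w = cayley e₃ z₃`. Hence `D_{a,b}` is biholomorphic to
`wedge = {(x, y) | x, y, x y ∈ H}`, on which the three functions are permuted by biholomorphic maps
(`isBiholomorphicMap_triangleMap`, `ratFun_triangleMap`, `isBiholomorphicMap_cycle`).

Let `(x, y)` and `(x', y')` be points of `wedge` such that, among the three coordinates, the first
is moved farthest in the hyperbolic distance. Then there is a holomorphic `h` on `H` with `h ζ ∈ H`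
and `ζ * h ζ ∈ H` for all `ζ ∈ H`, `h x = y` and `h x' = y'` (`exists_admissible`). The analytic
disc `ζ ↦ (ζ, h ζ)` and the Schwarz–Pick lemma then show that the first coordinate is extremal for the
two points (`carDist_wedge`). To find `h`, suppose first that the second coordinate is moved exactly
as far as the first. Then `h` is the real Möbius transformation with the prescribed values; the
imaginary part of `ζ * h ζ` is a Hermitian form in `(ζ, 1)` up to positive factors, and the
assumption on the third coordinate says that its Gram determinant on `(x, 1)`, `(x', 1)` is
nonnegative, so that the form is positive (`admissible_mobius`). If it is the third coordinate that
is moved as far as the first, the second and the third are exchanged. In general, shrinking `y'`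
along its ray, or `y` along its ray, leads to these extremal cases, and since the admissible
functions form a convex cone, a positive combination of the two functions obtained in this way has
the prescribed values.

Conversely, let `F` be extremal for two points at which the first coordinate is moved strictly
farthest. By the case of equality in the Schwarz–Pick lemma, `F` is an automorphism of the first
coordinate along the analytic disc, and the maximum principle in the fibres of the first coordinate
propagates this to an open set (`containsUpToAut_cayley_fst`). So every universal set contains the
three functions up to automorphisms, and it has at least three elements since none of the functions
determines another. As the bidisc has a universal set with two elements
(`isUniversalSet_bidisc`), it is not biholomorphic to `D_{a,b}`.
-/

namespace CaratheodoryUniversal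

/-! ### Schwarz–Pick on the disc -/

/-- The pseudohyperbolic distance on the unit disc, so that `hypDist = artanh ∘ pseudoDist`. -/
noncomputable def pseudoDist (u v : ℂ) : ℝ := ‖u - v‖ / ‖1 - (starRingEnd ℂ) v * u‖

/-- The disc automorphism `z ↦ (z - u) / (1 - conj u * z)`, which moves `u` to the origin. -/
noncomputable def discMob (u z : ℂ) : ℂ := (z - u) / (1 - (starRingEnd ℂ) u * z)

lemma hypDist_eq (u v : ℂ) : hypDist u v = Real.artanh (pseudoDist u v) := rfl

lemma norm_discMob (u z : ℂ) : ‖discMob u z‖ = pseudoDist z u := by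
  simp [discMob, pseudoDist]

lemma mem_disc {z : ℂ} : z ∈ disc ↔ ‖z‖ < 1 := by simp [disc]

lemma isOpen_disc : IsOpen disc := Metric.isOpen_ball

lemma one_sub_conj_mul_ne_zero {u z : ℂ} (hu : u ∈ disc) (hz : z ∈ disc) :
    1 - (starRingEnd ℂ) u * z ≠ 0 := by
  rw [mem_disc] at hu hz
  intro h
  have h1 : (starRingEnd ℂ) u * z = 1 := (sub_eq_zero.1 h).symm
  have h2 : ‖u‖ * ‖z‖ = 1 := by simpa using congrArg norm h1
  nlinarith [norm_nonneg u, norm_nonneg z]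

lemma discMob_mem_disc {u z : ℂ} (hu : u ∈ disc) (hz : z ∈ disc) : discMob u z ∈ disc := by
  have h0 := one_sub_conj_mul_ne_zero hu hz
  rw [mem_disc] at *
  rw [discMob, norm_div, div_lt_one (norm_pos_iff.2 h0)]
  rw [← sq_lt_sq₀ (norm_nonneg _) (norm_nonneg _)]
  have hu2 : ‖u‖ ^ 2 < 1 := by nlinarith [norm_nonneg u]
  have hz2 : ‖z‖ ^ 2 < 1 := by nlinarith [norm_nonneg z]
  rw [← Complex.normSq_eq_norm_sq, Complex.normSq_apply] at *
  rw [← Complex.normSq_eq_norm_sq, Complex.normSq_apply] at *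
  simp only [Complex.sub_re, Complex.sub_im, Complex.mul_re, Complex.mul_im, Complex.conj_re,
    Complex.conj_im, Complex.one_re, Complex.one_im] at *
  nlinarith [mul_pos (sub_pos.2 hu2) (sub_pos.2 hz2)]

lemma neg_mem_disc {u : ℂ} (hu : u ∈ disc) : -u ∈ disc := by
  rw [mem_disc] at *; simpa using hu

lemma discMob_neg_discMob {u z : ℂ} (hu : u ∈ disc) (hz : z ∈ disc) :
    discMob (-u) (discMob u z) = z := by
  have h0 := one_sub_conj_mul_ne_zero hu hz
  have h1 := one_sub_conj_mul_ne_zero hu hu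
  have h2 : (z - u) / (1 - (starRingEnd ℂ) u * z) - -u
      = z * (1 - (starRingEnd ℂ) u * u) / (1 - (starRingEnd ℂ) u * z) := by
    rw [eq_div_iff h0, sub_mul, div_mul_cancel₀ _ h0]; ring
  have h3 : 1 - -(starRingEnd ℂ) u * ((z - u) / (1 - (starRingEnd ℂ) u * z))
      = (1 - (starRingEnd ℂ) u * u) / (1 - (starRingEnd ℂ) u * z) := by
    rw [eq_div_iff h0, sub_mul, mul_assoc, div_mul_cancel₀ _ h0]; ring
  simp only [discMob, map_neg]
  rw [h2, h3, div_div_div_cancel_right₀ h0, mul_div_cancel_right₀ _ h1]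

lemma discMob_discMob_neg {u z : ℂ} (hu : u ∈ disc) (hz : z ∈ disc) :
    discMob u (discMob (-u) z) = z := by
  simpa using discMob_neg_discMob (neg_mem_disc hu) hz

lemma differentiableOn_discMob {u : ℂ} (hu : u ∈ disc) :
    DifferentiableOn ℂ (discMob u) disc := by
  unfold discMob
  refine DifferentiableOn.div (by fun_prop) (by fun_prop) fun z hz => ?_
  exact one_sub_conj_mul_ne_zero hu hz

@[simp] lemma discMob_self (u : ℂ) : discMob u u = 0 := by simp [discMob]

@[simp] lemma discMob_neg_zero (u : ℂ) : discMob (-u) 0 = u := by simp [discMob]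

lemma pseudoDist_comm (u v : ℂ) : pseudoDist u v = pseudoDist v u := by
  unfold pseudoDist
  rw [norm_sub_rev, ← Complex.norm_conj (1 - (starRingEnd ℂ) v * u)]
  simp [mul_comm]

lemma pseudoDist_lt_one {u v : ℂ} (hu : u ∈ disc) (hv : v ∈ disc) : pseudoDist u v < 1 := by
  rw [← norm_discMob]; exact mem_disc.1 (discMob_mem_disc hv hu)

lemma pseudoDist_nonneg (u v : ℂ) : 0 ≤ pseudoDist u v := by unfold pseudoDist; positivity

lemma pseudoDist_mem_Ioo {u v : ℂ} (hu : u ∈ disc) (hv : v ∈ disc) :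
    pseudoDist u v ∈ Ioo (-1 : ℝ) 1 :=
  ⟨by linarith [pseudoDist_nonneg u v], pseudoDist_lt_one hu hv⟩

lemma pseudoDist_eq_zero {u v : ℂ} (hu : u ∈ disc) (hv : v ∈ disc) :
    pseudoDist u v = 0 ↔ u = v := by
  have h := one_sub_conj_mul_ne_zero hv hu
  simp [pseudoDist, h, sub_eq_zero]

lemma hypDist_nonneg (u v : ℂ) : 0 ≤ hypDist u v :=
  Real.artanh_nonneg (pseudoDist_nonneg u v)

lemma ofReal_hypDist_le_iff {u v u' v' : ℂ} (hu : u ∈ disc) (hv : v ∈ disc) (hu' : u' ∈ disc)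
    (hv' : v' ∈ disc) :
    ENNReal.ofReal (hypDist u v) ≤ ENNReal.ofReal (hypDist u' v') ↔
      pseudoDist u v ≤ pseudoDist u' v' := by
  rw [ENNReal.ofReal_le_ofReal_iff (hypDist_nonneg _ _), hypDist_eq, hypDist_eq,
    Real.artanh_le_artanh_iff (pseudoDist_mem_Ioo hu hv) (pseudoDist_mem_Ioo hu' hv')]

/-- A holomorphic self-map `g` of the disc, normalized to fix the origin: `g` is followed and
preceded by the automorphisms that exchange `g t`, resp. `t`, with `0`. -/
lemma differentiableOn_mapsTo_normalized {g : ℂ → ℂ} (hg : DifferentiableOn ℂ g disc)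
    (hm : MapsTo g disc disc) {t : ℂ} (ht : t ∈ disc) :
    DifferentiableOn ℂ (fun z => discMob (g t) (g (discMob (-t) z))) disc ∧
      MapsTo (fun z => discMob (g t) (g (discMob (-t) z))) disc disc := by
  have h1 : MapsTo (discMob (-t)) disc disc := fun z hz => discMob_mem_disc (neg_mem_disc ht) hz
  refine ⟨?_, fun z hz => discMob_mem_disc (hm ht) (hm (h1 hz))⟩
  exact (differentiableOn_discMob (hm ht)).comp
    (hg.comp (differentiableOn_discMob (neg_mem_disc ht)) h1) (hm.comp h1)

/-- The Schwarz–Pick lemma. -/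
theorem pseudoDist_le_of_mapsTo {g : ℂ → ℂ} (hg : DifferentiableOn ℂ g disc)
    (hm : MapsTo g disc disc) {s t : ℂ} (hs : s ∈ disc) (ht : t ∈ disc) :
    pseudoDist (g s) (g t) ≤ pseudoDist s t := by
  obtain ⟨h1, h2⟩ := differentiableOn_mapsTo_normalized hg hm ht
  have h3 := Complex.norm_le_norm_of_mapsTo_ball (z := discMob t s) h1
    (fun z hz => Metric.ball_subset_closedBall (h2 hz)) (by simp)
    (mem_disc.1 (discMob_mem_disc ht hs))
  rw [discMob_neg_discMob ht hs] at h3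
  simpa [norm_discMob] using h3

lemma isBiholomorphicMap_discMob {u : ℂ} (hu : u ∈ disc) :
    IsBiholomorphicMap (discMob u) disc disc :=
  ⟨differentiableOn_discMob hu, fun _ hz => discMob_mem_disc hu hz, discMob (-u),
    differentiableOn_discMob (neg_mem_disc hu),
    fun _ hz => discMob_mem_disc (neg_mem_disc hu) hz,
    fun _ hz => discMob_neg_discMob hu hz, fun _ hz => discMob_discMob_neg hu hz⟩

section
variable {E E' E'' : Type*} [NormedAddCommGroup E] [NormedSpace ℂ E]
  [NormedAddCommGroup E'] [NormedSpace ℂ E'] [NormedAddCommGroup E''] [NormedSpace ℂ E'']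

lemma IsBiholomorphicMap.comp {D : Set E} {D' : Set E'} {D'' : Set E''} {f : E → E'}
    {g : E' → E''} (hg : IsBiholomorphicMap g D' D'') (hf : IsBiholomorphicMap f D D') :
    IsBiholomorphicMap (g ∘ f) D D'' := by
  obtain ⟨f1, f2, f', f3, f4, f5, f6⟩ := hf
  obtain ⟨g1, g2, g', g3, g4, g5, g6⟩ := hg
  exact ⟨g1.comp f1 f2, g2.comp f2, f' ∘ g', f3.comp g3 g4, f4.comp g4,
    fun x hx => by simp [g5 (f2 hx), f5 hx], fun x hx => by simp [f6 (g4 hx), g6 hx]⟩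

lemma IsBiholomorphicMap.congr {D : Set E} {D' : Set E'} {f g : E → E'}
    (hf : IsBiholomorphicMap f D D') (h : EqOn g f D) : IsBiholomorphicMap g D D' := by
  obtain ⟨f1, f2, f', f3, f4, f5, f6⟩ := hf
  refine ⟨f1.congr h, f2.congr h.symm, f', f3, f4, fun x hx => ?_, fun x hx => ?_⟩
  · rw [h hx, f5 hx]
  · rw [h (f4 hx), f6 hx]

lemma IsBiholomorphicMap.symm {D : Set E} {D' : Set E'} {f : E → E'}
    (hf : IsBiholomorphicMap f D D') : ∃ g, IsBiholomorphicMap g D' D ∧ LeftInvOn g f D ∧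
      RightInvOn g f D' := by
  obtain ⟨f1, f2, f', f3, f4, f5, f6⟩ := hf
  exact ⟨f', ⟨f3, f4, f, f1, f2, f6, f5⟩, f5, f6⟩

end

lemma isBiholomorphicMap_const_mul {c : ℂ} (hc : ‖c‖ = 1) :
    IsBiholomorphicMap (fun z => c * z) disc disc := by
  have h0 : c ≠ 0 := by rintro rfl; simp at hc
  refine ⟨by fun_prop, fun z hz => ?_, fun z => c⁻¹ * z, by fun_prop, fun z hz => ?_,
    fun z _ => ?_, fun z _ => ?_⟩
  · rw [mem_disc] at *; simpa [hc] using hz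
  · rw [mem_disc] at *; simpa [hc] using hz
  · simp [h0]
  · simp [h0]

/-- The case of equality in the Schwarz–Pick lemma. -/
theorem isBiholomorphicMap_of_pseudoDist_eq {g : ℂ → ℂ} (hg : DifferentiableOn ℂ g disc)
    (hm : MapsTo g disc disc) {s t : ℂ} (hs : s ∈ disc) (ht : t ∈ disc) (hst : s ≠ t)
    (h : pseudoDist (g s) (g t) = pseudoDist s t) : IsBiholomorphicMap g disc disc := by
  obtain ⟨h1, h2⟩ := differentiableOn_mapsTo_normalized hg hm ht
  set G := fun z => discMob (g t) (g (discMob (-t) z)) with hG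
  have hG0 : G 0 = 0 := by simp [hG]
  have hz : discMob t s ∈ disc := discMob_mem_disc ht hs
  have hz0 : ‖discMob t s‖ ≠ 0 := by rw [norm_discMob, Ne, pseudoDist_eq_zero hs ht]; exact hst
  have hGz : ‖G (discMob t s)‖ = ‖discMob t s‖ := by
    simp only [hG]; rw [discMob_neg_discMob ht hs, norm_discMob, norm_discMob, h]
  obtain ⟨c, hc, hGc⟩ := Complex.affine_of_mapsTo_ball_of_exists_norm_dslope_eq_div'
    (R₂ := 1) h1 (fun z hz => by
      rw [hG0]; exact Metric.ball_subset_closedBall (h2 hz)) ⟨discMob t s, hz, by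
      rw [dslope_of_ne _ (by simpa using hz0), slope_def_field, hG0, sub_zero, sub_zero,
        norm_div, hGz, div_self hz0, div_one]⟩
  rw [div_one] at hc
  refine ((isBiholomorphicMap_discMob (neg_mem_disc (hm ht))).comp
    ((isBiholomorphicMap_const_mul hc).comp (isBiholomorphicMap_discMob ht))).congr
    fun z hz => ?_
  have h3 := hGc (discMob_mem_disc ht hz)
  simp only [hG0, zero_add, sub_zero, smul_eq_mul] at h3
  simp only [Function.comp_apply]
  rw [mul_comm, ← h3]
  simp only [hG]
  rw [discMob_neg_discMob ht hz, discMob_neg_discMob (hm ht) (hm hz)]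

lemma IsBiholomorphicMap.pseudoDist_eq {φ : ℂ → ℂ} (hφ : IsBiholomorphicMap φ disc disc)
    {s t : ℂ} (hs : s ∈ disc) (ht : t ∈ disc) :
    pseudoDist (φ s) (φ t) = pseudoDist s t := by
  obtain ⟨f1, f2, f', f3, f4, f5, f6⟩ := hφ
  refine le_antisymm (pseudoDist_le_of_mapsTo f1 f2 hs ht) ?_
  simpa [f5 hs, f5 ht] using pseudoDist_le_of_mapsTo f3 f4 (f2 hs) (f2 ht)

/-! ### The Carathéodory pseudodistance and universal sets -/

section
variable {E E' : Type*} [NormedAddCommGroup E] [NormedSpace ℂ E]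
  [NormedAddCommGroup E'] [NormedSpace ℂ E']

lemma le_carDist {D : Set E} {F : E → ℂ} (hF : F ∈ holoToDisc D) (w z : E) :
    ENNReal.ofReal (hypDist (F w) (F z)) ≤ carDist D w z :=
  le_iSup₂ (f := fun F (_ : F ∈ holoToDisc D) => ENNReal.ofReal (hypDist (F w) (F z))) F hF

/-- If an analytic disc `h` in `D` is mapped isometrically by `F` at two of its points, then `F` is
extremal for these points: the left inverse of a complex geodesic attains the Carathéodory
pseudodistance. -/
lemma carDist_eq_of_analytic_disc {D : Set E} {F : E → ℂ} (hF : F ∈ holoToDisc D) {h : ℂ → E}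
    (hd : DifferentiableOn ℂ h disc) (hm : MapsTo h disc D) {s t : ℂ} (hs : s ∈ disc)
    (ht : t ∈ disc) (heq : pseudoDist s t = pseudoDist (F (h s)) (F (h t))) :
    carDist D (h s) (h t) = ENNReal.ofReal (hypDist (F (h s)) (F (h t))) := by
  refine le_antisymm (iSup₂_le fun G hG => ?_) (le_carDist hF _ _)
  rw [ofReal_hypDist_le_iff (hG.2 (hm hs)) (hG.2 (hm ht)) (hF.2 (hm hs)) (hF.2 (hm ht)), ← heq]
  exact pseudoDist_le_of_mapsTo (hG.1.comp hd hm) (hG.2.comp hm) hs ht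

lemma holoToDisc_comp {D : Set E} {D' : Set E'} {k : E' → E} (hk : DifferentiableOn ℂ k D')
    (hm : MapsTo k D' D) {F : E → ℂ} (hF : F ∈ holoToDisc D) : F ∘ k ∈ holoToDisc D' :=
  ⟨hF.1.comp hk hm, hF.2.comp hm⟩

lemma carDist_comp_le {D : Set E} {D' : Set E'} {k : E' → E} (hk : DifferentiableOn ℂ k D')
    (hm : MapsTo k D' D) (w z : E') : carDist D (k w) (k z) ≤ carDist D' w z :=
  iSup₂_le fun _ hF => le_carDist (holoToDisc_comp hk hm hF) w z

/-- The Carathéodory pseudodistance is a biholomorphic invariant. -/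
lemma IsBiholomorphicMap.carDist_eq {D : Set E} {D' : Set E'} {k : E' → E}
    (hk : IsBiholomorphicMap k D' D) {w z : E'} (hw : w ∈ D') (hz : z ∈ D') :
    carDist D (k w) (k z) = carDist D' w z := by
  obtain ⟨f1, f2, f', f3, f4, f5, f6⟩ := hk
  refine le_antisymm (carDist_comp_le f1 f2 w z) ?_
  simpa [f5 hw, f5 hz] using carDist_comp_le f3 f4 (k w) (k z)

/-- Universal sets pull back along biholomorphic maps. -/
lemma IsUniversalSet.comp {D : Set E} {D' : Set E'} {k : E' → E} {C : Set (E → ℂ)}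
    (hC : IsUniversalSet D C) (hk : IsBiholomorphicMap k D' D) :
    IsUniversalSet D' ((fun F => F ∘ k) '' C) := by
  refine ⟨?_, fun w hw z hz hwz => ?_⟩
  · rintro _ ⟨F, hF, rfl⟩
    exact holoToDisc_comp hk.1 hk.2.1 (hC.1 hF)
  · obtain ⟨g, -, hg, -⟩ := hk.symm
    obtain ⟨F, hF, h⟩ := hC.2 _ (hk.2.1 hw) _ (hk.2.1 hz) fun h => hwz (by
      rw [← hg hw, ← hg hz, h])
    exact ⟨_, ⟨F, hF, rfl⟩, by rw [← hk.carDist_eq hw hz, h]; rfl⟩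

/-- If the pullback of `C` along a biholomorphic map contains the pullback of `f` up to
automorphisms, then so does `C`. -/
lemma ContainsUpToAut.of_comp {D : Set E} {D' : Set E'} {k : E' → E} {C : Set (E → ℂ)}
    (hk : IsBiholomorphicMap k D' D) {f : E → ℂ} {f' : E' → ℂ} (hf : EqOn (f ∘ k) f' D')
    (h : ContainsUpToAut D' ((fun F => F ∘ k) '' C) f') : ContainsUpToAut D C f := by
  obtain ⟨φ, hφ, _, ⟨F, hF, rfl⟩, hE⟩ := h
  obtain ⟨g, hg, -, hr⟩ := hk.symm
  refine ⟨φ, hφ, F, hF, fun z hz => ?_⟩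
  have h1 := hE (hg.2.1 hz)
  have h2 := hf (hg.2.1 hz)
  simp only [Function.comp_apply, hr hz] at h1 h2 ⊢
  rw [h1, h2]

end

/-! ### The bidisc -/

lemma exists_selfMap_disc {w₁ w₂ z₁ z₂ : ℂ} (hw₁ : w₁ ∈ disc) (hw₂ : w₂ ∈ disc) (hz₁ : z₁ ∈ disc)
    (hz₂ : z₂ ∈ disc) (hne : w₁ ≠ z₁) (hle : pseudoDist z₂ w₂ ≤ pseudoDist z₁ w₁) :
    ∃ k : ℂ → ℂ, DifferentiableOn ℂ k disc ∧ MapsTo k disc disc ∧ k w₁ = w₂ ∧ k z₁ = z₂ := by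
  have h0 : pseudoDist z₁ w₁ ≠ 0 := by rw [Ne, pseudoDist_eq_zero hz₁ hw₁]; exact hne.symm
  have h1 : discMob w₁ z₁ ≠ 0 := by rwa [← norm_ne_zero_iff, norm_discMob]
  set c := discMob w₂ z₂ / discMob w₁ z₁ with hc
  have hc1 : ‖c‖ ≤ 1 := by
    rw [hc, norm_div, norm_discMob, norm_discMob]
    exact div_le_one_of_le₀ hle (pseudoDist_nonneg _ _)
  have hm : MapsTo (fun z => c * discMob w₁ z) disc disc := fun z hz => by
    have := mem_disc.1 (discMob_mem_disc hw₁ hz)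
    rw [mem_disc, norm_mul]
    nlinarith [norm_nonneg c, norm_nonneg (discMob w₁ z)]
  refine ⟨fun z => discMob (-w₂) (c * discMob w₁ z), ?_, ?_, ?_, ?_⟩
  · exact (differentiableOn_discMob (neg_mem_disc hw₂)).comp
      ((differentiableOn_discMob hw₁).const_mul c) hm
  · exact fun z hz => discMob_mem_disc (neg_mem_disc hw₂) (hm hz)
  · simp
  · simp only [hc]; rw [div_mul_cancel₀ _ h1, discMob_neg_discMob hw₂ hz₂]

/-- The two coordinate functions form a universal set for the bidisc. -/
theorem isUniversalSet_bidisc : IsUniversalSet bidisc {Prod.fst, Prod.snd} := by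
  have hf : (Prod.fst : ℂ × ℂ → ℂ) ∈ holoToDisc bidisc :=
    ⟨differentiable_fst.differentiableOn, fun z hz => hz.1⟩
  have hs : (Prod.snd : ℂ × ℂ → ℂ) ∈ holoToDisc bidisc :=
    ⟨differentiable_snd.differentiableOn, fun z hz => hz.2⟩
  refine ⟨by rintro F (rfl | rfl) <;> assumption, ?_⟩
  rintro ⟨w₁, w₂⟩ ⟨hw₁, hw₂⟩ ⟨z₁, z₂⟩ ⟨hz₁, hz₂⟩ hne
  simp only at hw₁ hw₂ hz₁ hz₂
  rcases le_total (pseudoDist z₂ w₂) (pseudoDist z₁ w₁) with h | h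
  · have hne1 : w₁ ≠ z₁ := by
      rintro rfl
      rw [(pseudoDist_eq_zero hw₁ hw₁).2 rfl] at h
      exact hne (by rw [(pseudoDist_eq_zero hz₂ hw₂).1 (h.antisymm (pseudoDist_nonneg _ _))])
    obtain ⟨k, hk1, hk2, hk3, hk4⟩ := exists_selfMap_disc hw₁ hw₂ hz₁ hz₂ hne1 h
    refine ⟨Prod.fst, by simp, ?_⟩
    have := carDist_eq_of_analytic_disc (D := bidisc) hf (h := fun z => (z, k z))
      (differentiableOn_id.prodMk hk1) (fun z hz => ⟨hz, hk2 hz⟩) hw₁ hz₁ rfl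
    simpa only [hk3, hk4] using this
  · have hne1 : w₂ ≠ z₂ := by
      rintro rfl
      rw [(pseudoDist_eq_zero hw₂ hw₂).2 rfl] at h
      exact hne (by rw [(pseudoDist_eq_zero hz₁ hw₁).1 (h.antisymm (pseudoDist_nonneg _ _))])
    obtain ⟨k, hk1, hk2, hk3, hk4⟩ := exists_selfMap_disc hw₂ hw₁ hz₂ hz₁ hne1 h
    refine ⟨Prod.snd, by simp, ?_⟩
    have := carDist_eq_of_analytic_disc (D := bidisc) hs (h := fun z => (k z, z))
      (hk1.prodMk differentiableOn_id) (fun z hz => ⟨hk2 hz, hz⟩) hw₂ hz₂ rfl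
    simpa only [hk3, hk4] using this

/-! ### The upper half-plane -/

/-- The open upper half-plane, as a subset of `ℂ`. -/
def upperHalf : Set ℂ := {z | 0 < z.im}

lemma mem_upperHalf {z : ℂ} : z ∈ upperHalf ↔ 0 < z.im := Iff.rfl

lemma isOpen_upperHalf : IsOpen upperHalf := isOpen_lt continuous_const Complex.continuous_im

lemma ne_zero_of_mem_upperHalf {z : ℂ} (hz : z ∈ upperHalf) : z ≠ 0 := by
  rintro rfl; simp [upperHalf] at hz

/-- The pseudohyperbolic distance on the upper half-plane. -/
noncomputable def halfDist (u v : ℂ) : ℝ := ‖u - v‖ / ‖u - (starRingEnd ℂ) v‖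

/-- For `‖e‖ = 1`, `0 < im e`, the involution `z ↦ (e - z) / (1 - e z)`, which exchanges the unit
disc with the upper half-plane and `0` with `e`. -/
noncomputable def cayley (e z : ℂ) : ℂ := (e - z) / (1 - e * z)

lemma re_sq_add_im_sq_of_norm_eq_one {e : ℂ} (he : ‖e‖ = 1) : e.re * e.re + e.im * e.im = 1 := by
  rw [← Complex.normSq_apply, Complex.normSq_eq_norm_sq, he, one_pow]

lemma one_sub_mul_ne_zero_of_mem_disc {e : ℂ} (he : ‖e‖ = 1) {z : ℂ} (hz : z ∈ disc) :
    1 - e * z ≠ 0 := by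
  intro h
  have h1 : ‖e * z‖ = 1 := by rw [← sub_eq_zero.1 h, norm_one]
  rw [norm_mul, he, one_mul] at h1
  exact absurd (mem_disc.1 hz) (by simp [h1])

lemma one_sub_mul_ne_zero_of_mem_upperHalf {e : ℂ} (he : ‖e‖ = 1) (hi : 0 < e.im) {z : ℂ}
    (hz : z ∈ upperHalf) : 1 - e * z ≠ 0 := by
  intro h
  have h1 := congrArg Complex.re h
  have h2 := congrArg Complex.im h
  have h3 := re_sq_add_im_sq_of_norm_eq_one he
  rw [mem_upperHalf] at hz
  simp at h1 h2
  have : z.im + e.im = 0 := by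
    linear_combination e.im * h1 - e.re * h2 - z.im * h3
  linarith

lemma one_sub_sq_ne_zero {e : ℂ} (he : ‖e‖ = 1) (hi : 0 < e.im) : 1 - e * e ≠ 0 :=
  one_sub_mul_ne_zero_of_mem_upperHalf he hi (mem_upperHalf.2 hi)

lemma cayley_cayley {e : ℂ} (he : ‖e‖ = 1) (hi : 0 < e.im) {z : ℂ} (hz : 1 - e * z ≠ 0) :
    cayley e (cayley e z) = z := by
  have h1 := one_sub_sq_ne_zero he hi
  have h2 : e - (e - z) / (1 - e * z) = z * (1 - e * e) / (1 - e * z) := by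
    rw [eq_div_iff hz, sub_mul, div_mul_cancel₀ _ hz]; ring
  have h3 : 1 - e * ((e - z) / (1 - e * z)) = (1 - e * e) / (1 - e * z) := by
    rw [eq_div_iff hz, sub_mul, mul_assoc, div_mul_cancel₀ _ hz]; ring
  unfold cayley
  rw [h2, h3, div_div_div_cancel_right₀ hz, mul_div_cancel_right₀ _ h1]

lemma cayley_mem_upperHalf {e : ℂ} (he : ‖e‖ = 1) (hi : 0 < e.im) {z : ℂ} (hz : z ∈ disc) :
    cayley e z ∈ upperHalf := by
  have h0 := one_sub_mul_ne_zero_of_mem_disc he hz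
  have h3 := re_sq_add_im_sq_of_norm_eq_one he
  have hz2 : ‖z‖ ^ 2 < 1 := by nlinarith [norm_nonneg z, mem_disc.1 hz]
  rw [← Complex.normSq_eq_norm_sq, Complex.normSq_apply] at hz2
  rw [mem_upperHalf, cayley, Complex.div_im, ← sub_div]
  refine div_pos ?_ (Complex.normSq_pos.2 h0)
  simp only [Complex.sub_re, Complex.sub_im, Complex.mul_re, Complex.mul_im, Complex.one_re,
    Complex.one_im]
  have h := mul_pos hi (sub_pos.2 hz2)
  refine h.trans_eq ?_
  linear_combination -z.im * h3

lemma norm_sub_lt_norm_one_sub_mul_iff {e : ℂ} (he : ‖e‖ = 1) (hi : 0 < e.im) {z : ℂ} :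
    ‖e - z‖ < ‖1 - e * z‖ ↔ 0 < z.im := by
  have h3 := re_sq_add_im_sq_of_norm_eq_one he
  have h : Complex.normSq (1 - e * z) - Complex.normSq (e - z) = 4 * e.im * z.im := by
    simp only [Complex.normSq_apply, Complex.sub_re, Complex.sub_im, Complex.mul_re,
      Complex.mul_im, Complex.one_re, Complex.one_im]
    linear_combination (z.re * z.re + z.im * z.im - 1) * h3
  rw [← sq_lt_sq₀ (norm_nonneg _) (norm_nonneg _), ← Complex.normSq_eq_norm_sq,
    ← Complex.normSq_eq_norm_sq, ← sub_pos, h]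
  exact mul_pos_iff_of_pos_left (by linarith)

lemma cayley_mem_disc {e : ℂ} (he : ‖e‖ = 1) (hi : 0 < e.im) {z : ℂ} (hz : z ∈ upperHalf) :
    cayley e z ∈ disc := by
  have h0 := one_sub_mul_ne_zero_of_mem_upperHalf he hi hz
  rw [mem_disc, cayley, norm_div, div_lt_one (norm_pos_iff.2 h0)]
  exact (norm_sub_lt_norm_one_sub_mul_iff he hi).2 hz

lemma differentiableOn_cayley_disc {e : ℂ} (he : ‖e‖ = 1) : DifferentiableOn ℂ (cayley e) disc :=
  DifferentiableOn.div (by fun_prop) (by fun_prop) fun _ hz =>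
    one_sub_mul_ne_zero_of_mem_disc he hz

lemma differentiableOn_cayley_upperHalf {e : ℂ} (he : ‖e‖ = 1) (hi : 0 < e.im) :
    DifferentiableOn ℂ (cayley e) upperHalf :=
  DifferentiableOn.div (by fun_prop) (by fun_prop) fun _ hz =>
    one_sub_mul_ne_zero_of_mem_upperHalf he hi hz

lemma cayley_cayley_of_mem_disc {e : ℂ} (he : ‖e‖ = 1) (hi : 0 < e.im) {z : ℂ} (hz : z ∈ disc) :
    cayley e (cayley e z) = z :=
  cayley_cayley he hi (one_sub_mul_ne_zero_of_mem_disc he hz)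

lemma cayley_cayley_of_mem_upperHalf {e : ℂ} (he : ‖e‖ = 1) (hi : 0 < e.im) {z : ℂ}
    (hz : z ∈ upperHalf) : cayley e (cayley e z) = z :=
  cayley_cayley he hi (one_sub_mul_ne_zero_of_mem_upperHalf he hi hz)

lemma pseudoDist_cayley {e : ℂ} (he : ‖e‖ = 1) (hi : 0 < e.im) {u v : ℂ} (hu : u ∈ upperHalf)
    (hv : v ∈ upperHalf) :
    pseudoDist (cayley e u) (cayley e v) = halfDist u v := by
  have hu0 := one_sub_mul_ne_zero_of_mem_upperHalf he hi hu
  have hv0 := one_sub_mul_ne_zero_of_mem_upperHalf he hi hv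
  have hv0' : 1 - (starRingEnd ℂ) e * (starRingEnd ℂ) v ≠ 0 := by
    have := (map_ne_zero (starRingEnd ℂ)).2 hv0; simpa using this
  have h1 := one_sub_sq_ne_zero he hi
  have hee : e * (starRingEnd ℂ) e = 1 := by
    rw [Complex.mul_conj, Complex.normSq_eq_norm_sq, he]; simp
  have hA : cayley e u - cayley e v
      = (u - v) * -(1 - e * e) / ((1 - e * u) * (1 - e * v)) := by
    unfold cayley
    rw [div_sub_div _ _ hu0 hv0]; ring
  have hB : 1 - (starRingEnd ℂ) (cayley e v) * cayley e u
      = (u - (starRingEnd ℂ) v) * ((starRingEnd ℂ) e * (1 - e * e)) /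
        ((1 - e * u) * (1 - (starRingEnd ℂ) e * (starRingEnd ℂ) v)) := by
    simp only [cayley, map_div₀, map_sub, map_mul, map_one]
    rw [eq_div_iff (mul_ne_zero hu0 hv0'), sub_mul, div_mul_div_comm,
      mul_comm (1 - e * u), div_mul_cancel₀ _ (mul_ne_zero hv0' hu0)]
    linear_combination (u * (starRingEnd ℂ) v - 1 + e * (u - (starRingEnd ℂ) v)) * hee
  have hN : ‖1 - (starRingEnd ℂ) e * (starRingEnd ℂ) v‖ = ‖1 - e * v‖ := by
    rw [← Complex.norm_conj (1 - e * v)]; simp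
  have h1' : ‖1 - e * e‖ ≠ 0 := norm_ne_zero_iff.2 h1
  have hD : ‖1 - e * u‖ * ‖1 - e * v‖ ≠ 0 := by
    rw [← norm_mul]; exact norm_ne_zero_iff.2 (mul_ne_zero hu0 hv0)
  rw [pseudoDist, hA, hB, norm_div, norm_div, norm_mul, norm_mul, norm_mul, norm_mul, norm_mul,
    norm_neg, hN, div_div_div_cancel_right₀ hD, Complex.norm_conj, he, one_mul,
    mul_div_mul_right _ _ h1', halfDist]

lemma sub_conj_ne_zero {u v : ℂ} (hu : u ∈ upperHalf) (hv : 0 ≤ v.im) :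
    u - (starRingEnd ℂ) v ≠ 0 := by
  intro h
  have := congrArg Complex.im h
  rw [mem_upperHalf] at hu
  simp at this
  linarith

lemma halfDist_nonneg (u v : ℂ) : 0 ≤ halfDist u v := by unfold halfDist; positivity

lemma halfDist_comm (u v : ℂ) : halfDist u v = halfDist v u := by
  unfold halfDist
  rw [norm_sub_rev, ← Complex.norm_conj (u - (starRingEnd ℂ) v), map_sub, Complex.conj_conj,
    norm_sub_rev ((starRingEnd ℂ) u)]

lemma halfDist_sq {u v : ℂ} (hu : u ∈ upperHalf) (hv : 0 ≤ v.im) :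
    1 - halfDist u v ^ 2 = 4 * (u.im * v.im) / Complex.normSq (u - (starRingEnd ℂ) v) := by
  have h0 := Complex.normSq_pos.2 (sub_conj_ne_zero hu hv)
  rw [halfDist, div_pow, ← Complex.normSq_eq_norm_sq, ← Complex.normSq_eq_norm_sq,
    eq_div_iff h0.ne', sub_mul, div_mul_cancel₀ _ h0.ne']
  simp only [Complex.normSq_apply, Complex.sub_re, Complex.sub_im, Complex.conj_re,
    Complex.conj_im]
  ring

lemma halfDist_lt_one {u v : ℂ} (hu : u ∈ upperHalf) (hv : v ∈ upperHalf) : halfDist u v < 1 := by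
  have h := halfDist_sq hu (mem_upperHalf.1 hv).le
  have h0 := Complex.normSq_pos.2 (sub_conj_ne_zero hu (mem_upperHalf.1 hv).le)
  have : 0 < 4 * (u.im * v.im) / Complex.normSq (u - (starRingEnd ℂ) v) :=
    div_pos (by have := mul_pos (mem_upperHalf.1 hu) (mem_upperHalf.1 hv); linarith) h0
  nlinarith [halfDist_nonneg u v]

lemma halfDist_eq_zero {u v : ℂ} (hu : u ∈ upperHalf) (hv : v ∈ upperHalf) :
    halfDist u v = 0 ↔ u = v := by
  simp [halfDist, sub_conj_ne_zero hu (mem_upperHalf.1 hv).le, sub_eq_zero]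

lemma halfDist_le_iff {u v u' v' : ℂ} (hu : u ∈ upperHalf) (hv : v ∈ upperHalf)
    (hu' : u' ∈ upperHalf) (hv' : v' ∈ upperHalf) :
    halfDist u v ≤ halfDist u' v' ↔ u'.im * v'.im * Complex.normSq (u - (starRingEnd ℂ) v) ≤
      u.im * v.im * Complex.normSq (u' - (starRingEnd ℂ) v') := by
  have h0 := Complex.normSq_pos.2 (sub_conj_ne_zero hu (mem_upperHalf.1 hv).le)
  have h0' := Complex.normSq_pos.2 (sub_conj_ne_zero hu' (mem_upperHalf.1 hv').le)
  rw [← sq_le_sq₀ (halfDist_nonneg _ _) (halfDist_nonneg _ _), ← sub_le_sub_iff_left 1,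
    halfDist_sq hu (mem_upperHalf.1 hv).le, halfDist_sq hu' (mem_upperHalf.1 hv').le,
    div_le_div_iff₀ h0' h0]
  constructor <;> intro h <;> linarith

lemma neg_inv_mem_upperHalf {u : ℂ} (hu : u ∈ upperHalf) : -u⁻¹ ∈ upperHalf := by
  have h0 := Complex.normSq_pos.2 (ne_zero_of_mem_upperHalf hu)
  rw [mem_upperHalf] at *
  simp only [Complex.neg_im, Complex.inv_im, neg_div, neg_neg]
  positivity

lemma mul_neg_inv_mul {x : ℂ} (hx : x ∈ upperHalf) (y : ℂ) : x * -(x * y)⁻¹ = -y⁻¹ := by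
  rw [mul_inv, mul_neg, mul_inv_cancel_left₀ (ne_zero_of_mem_upperHalf hx)]

lemma halfDist_neg_inv {u v : ℂ} (hu : u ∈ upperHalf) (hv : v ∈ upperHalf) :
    halfDist (-u⁻¹) (-v⁻¹) = halfDist u v := by
  have hu0 := ne_zero_of_mem_upperHalf hu
  have hv0 := ne_zero_of_mem_upperHalf hv
  have hv0' : (starRingEnd ℂ) v ≠ 0 := (map_ne_zero _).2 hv0
  have h1 : -u⁻¹ - -v⁻¹ = (u - v) / (u * v) := by field_simp; ring
  have h2 : -u⁻¹ - (starRingEnd ℂ) (-v⁻¹)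
      = (u - (starRingEnd ℂ) v) / (u * (starRingEnd ℂ) v) := by
    simp only [map_neg, map_inv₀]; field_simp; ring
  have h3 : ‖u‖ * ‖v‖ ≠ 0 := by simp [hu0, hv0]
  rw [halfDist, h1, h2, norm_div, norm_div, norm_mul, norm_mul, Complex.norm_conj,
    div_div_div_cancel_right₀ h3, halfDist]

/-! ### Analytic discs over the upper half-plane -/

/-- Holomorphic functions `h` on the upper half-plane such that `ζ`, `h ζ` and `ζ * h ζ` all lie in
the upper half-plane, that is, whose graphs are analytic discs in `wedge`. -/
def Admissible (h : ℂ → ℂ) : Prop :=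
  DifferentiableOn ℂ h upperHalf ∧ ∀ ζ ∈ upperHalf, h ζ ∈ upperHalf ∧ ζ * h ζ ∈ upperHalf

lemma exists_sq_mul_eq {A B : ℂ} (h : ‖A‖ = ‖B‖) : ∃ u : ℂ, ‖u‖ = 1 ∧ u * u * A = B := by
  rcases eq_or_ne A 0 with rfl | hA
  · exact ⟨1, by simp, by simpa using (norm_eq_zero.1 (by simpa using h.symm) : B = 0).symm⟩
  · obtain ⟨u, hu⟩ := IsAlgClosed.exists_eq_mul_self (B / A)
    refine ⟨u, ?_, by rw [← hu, div_mul_cancel₀ _ hA]⟩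
    have h1 : ‖u‖ * ‖u‖ = 1 := by
      rw [← norm_mul, ← hu, norm_div, h, div_self]; rw [← h]; exact norm_ne_zero_iff.2 hA
    nlinarith [norm_nonneg u]

/-- Two pairs of points of the upper half-plane at the same distance are exchanged by a real
Möbius transformation. -/
lemma exists_real_mobius {x x' y y' : ℂ} (hx : x ∈ upperHalf) (hx' : x' ∈ upperHalf)
    (hy : y ∈ upperHalf) (hy' : y' ∈ upperHalf) (h : halfDist x' x = halfDist y' y) :
    ∃ α β γ δ : ℝ, 0 < α * δ - β * γ ∧ y * (γ * x + δ) = α * x + β ∧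
      y' * (γ * x' + δ) = α * x' + β := by
  have h1 := sub_conj_ne_zero hx' (mem_upperHalf.1 hx).le
  have h2 := sub_conj_ne_zero hy' (mem_upperHalf.1 hy).le
  have h3 : ‖(x' - x) * (y' - (starRingEnd ℂ) y)‖ = ‖(y' - y) * (x' - (starRingEnd ℂ) x)‖ := by
    rw [halfDist, halfDist, div_eq_div_iff (norm_ne_zero_iff.2 h1) (norm_ne_zero_iff.2 h2)] at h
    rw [norm_mul, norm_mul, h]
  -- `u` is the half-angle of the rotation about `i` which remains after moving both `x` and `y`
  -- to `i` by real affine maps.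
  obtain ⟨u, hu, huv⟩ := exists_sq_mul_eq h3
  have h4 := re_sq_add_im_sq_of_norm_eq_one hu
  have hcu : u * (starRingEnd ℂ) u = 1 := by
    rw [Complex.mul_conj, Complex.normSq_eq_norm_sq, hu]; simp
  have h5 : u * ((x' - x) * (y' - (starRingEnd ℂ) y))
      = (starRingEnd ℂ) u * ((y' - y) * (x' - (starRingEnd ℂ) x)) := by
    linear_combination (starRingEnd ℂ) u * huv
      - u * ((x' - x) * (y' - (starRingEnd ℂ) y)) * hcu
  obtain ⟨p, q⟩ := x
  obtain ⟨r, t⟩ := y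
  obtain ⟨c, s⟩ := u
  obtain ⟨m, n⟩ := x'
  obtain ⟨k, l⟩ := y'
  simp only [mem_upperHalf] at hx hy
  refine ⟨t * c - r * s, (t * s + r * c) * q - (t * c - r * s) * p, -s, c * q + s * p, ?_, ?_, ?_⟩
  · have : 0 < t * q * (c * c + s * s) := by simp only at h4; rw [h4]; positivity
    convert this using 1
    ring
  · simp only [Complex.ext_iff, Complex.mul_re, Complex.mul_im, Complex.add_re, Complex.add_im,
      Complex.ofReal_re, Complex.ofReal_im]
    constructor <;> ring
  · have h6 := congrArg Complex.re h5
    have h7 := congrArg Complex.im h5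
    simp only [Complex.ext_iff, Complex.mul_re, Complex.mul_im, Complex.add_re, Complex.add_im,
      Complex.sub_re, Complex.sub_im, Complex.conj_re, Complex.conj_im,
      Complex.ofReal_re, Complex.ofReal_im] at h6 h7 ⊢
    constructor <;> linarith

section
variable {α β γ δ : ℝ}

lemma denom_ne_zero_of_mem_upperHalf (hdet : 0 < α * δ - β * γ) {ζ : ℂ} (hζ : ζ ∈ upperHalf) :
    (γ : ℂ) * ζ + δ ≠ 0 := by
  intro h
  have h1 := congrArg Complex.re h
  have h2 := congrArg Complex.im h
  rw [mem_upperHalf] at hζ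
  simp at h1 h2
  rcases h2 with h2 | h2
  · rw [h2, zero_mul, zero_add] at h1; rw [h1, h2] at hdet; simp at hdet
  · exact hζ.ne' h2

lemma im_mobius (ζ : ℂ) : ((α * ζ + β) / (γ * ζ + δ) : ℂ).im
    = ζ.im * (α * δ - β * γ) / Complex.normSq (γ * ζ + δ) := by
  rw [Complex.div_im, ← sub_div]
  congr 1
  simp
  ring

/-- The imaginary part of `ζ * m ζ` for a real Möbius transformation `m` is governed by a Hermitian
form in `(ζ, 1)`. -/
lemma im_mul_mobius (ζ : ℂ) : (ζ * ((α * ζ + β) / (γ * ζ + δ)) : ℂ).im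
    = ζ.im * (α * γ * Complex.normSq ζ + 2 * (α * δ) * ζ.re + β * δ)
      / Complex.normSq (γ * ζ + δ) := by
  rw [← mul_div_assoc, Complex.div_im, ← sub_div]
  congr 1
  simp [Complex.normSq_apply]
  ring

/-- Let `m` be a real Möbius transformation. If `ζ ↦ ζ * m ζ` maps two points into the upper
half-plane without increasing their distance, then it maps the whole half-plane into itself. The
hypothesis says that a Hermitian form has nonnegative Gram determinant on two independent vectors
on which it is positive, so that it is positive semidefinite. -/
lemma admissible_mobius (hdet : 0 < α * δ - β * γ) {x x' : ℂ} (hx : x ∈ upperHalf)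
    (hx' : x' ∈ upperHalf) (hne : x ≠ x')
    (hN : x * ((α * x + β) / (γ * x + δ)) ∈ upperHalf)
    (hN' : x' * ((α * x' + β) / (γ * x' + δ)) ∈ upperHalf)
    (hle : halfDist (x * ((α * x + β) / (γ * x + δ))) (x' * ((α * x' + β) / (γ * x' + δ))) ≤
      halfDist x x') :
    Admissible fun ζ => (α * ζ + β) / (γ * ζ + δ) := by
  have hd : ∀ ζ ∈ upperHalf, 0 < Complex.normSq (γ * ζ + δ) := fun ζ hζ =>
    Complex.normSq_pos.2 (denom_ne_zero_of_mem_upperHalf hdet hζ)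
  have hxd := denom_ne_zero_of_mem_upperHalf hdet hx
  have hxd' : (γ : ℂ) * (starRingEnd ℂ) x' + δ ≠ 0 := by
    have := (map_ne_zero (starRingEnd ℂ)).2 (denom_ne_zero_of_mem_upperHalf hdet hx')
    simpa using this
  have hnn : Complex.normSq (γ * (starRingEnd ℂ) x' + δ) = Complex.normSq (γ * x' + δ) := by
    rw [← Complex.normSq_conj]; simp
  have hsub : x * ((α * x + β) / (γ * x + δ)) -
      (starRingEnd ℂ) (x' * ((α * x' + β) / (γ * x' + δ)))
      = (x - (starRingEnd ℂ) x') * (α * γ * (x * (starRingEnd ℂ) x')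
        + α * δ * (x + (starRingEnd ℂ) x') + β * δ) /
        ((γ * x + δ) * (γ * (starRingEnd ℂ) x' + δ)) := by
    simp only [map_mul, map_div₀, map_add, Complex.conj_ofReal]
    rw [← mul_div_assoc, ← mul_div_assoc, div_sub_div _ _ hxd hxd']
    ring
  rw [halfDist_le_iff hN hN' hx hx', im_mul_mobius, im_mul_mobius, hsub, map_div₀, map_mul,
    map_mul, hnn] at hle
  have hQx : 0 < α * γ * Complex.normSq x + 2 * (α * δ) * x.re + β * δ := by
    rw [mem_upperHalf, im_mul_mobius, div_pos_iff_of_pos_right (hd x hx)] at hN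
    exact pos_of_mul_pos_right hN (mem_upperHalf.1 hx).le
  have hS := Complex.normSq_pos.2 (sub_conj_ne_zero hx (mem_upperHalf.1 hx').le)
  have hgram : Complex.normSq (α * γ * (x * (starRingEnd ℂ) x')
        + α * δ * (x + (starRingEnd ℂ) x') + β * δ) ≤
      (α * γ * Complex.normSq x + 2 * (α * δ) * x.re + β * δ) *
        (α * γ * Complex.normSq x' + 2 * (α * δ) * x'.re + β * δ) := by
    have hpos : 0 < x.im * x'.im * Complex.normSq (x - (starRingEnd ℂ) x') /
        (Complex.normSq (γ * x + δ) * Complex.normSq (γ * x' + δ)) :=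
      div_pos (mul_pos (mul_pos (mem_upperHalf.1 hx) (mem_upperHalf.1 hx')) hS)
        (mul_pos (hd x hx) (hd x' hx'))
    refine le_of_mul_le_mul_left ?_ hpos
    refine le_of_eq_of_le ?_ (hle.trans_eq ?_) <;> ring
  have hpsd : 0 ≤ (α * γ * (β * δ) - (α * δ) ^ 2) * Complex.normSq (x - x') := by
    have : (α * γ * (β * δ) - (α * δ) ^ 2) * Complex.normSq (x - x') =
      (α * γ * Complex.normSq x + 2 * (α * δ) * x.re + β * δ) *
        (α * γ * Complex.normSq x' + 2 * (α * δ) * x'.re + β * δ) -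
      Complex.normSq (α * γ * (x * (starRingEnd ℂ) x')
        + α * δ * (x + (starRingEnd ℂ) x') + β * δ) := by
      simp [Complex.normSq_apply]
      ring
    rw [this]; linarith
  have hdisc : 0 ≤ α * γ * (β * δ) - (α * δ) ^ 2 :=
    nonneg_of_mul_nonneg_left hpsd (Complex.normSq_pos.2 (sub_ne_zero.2 hne))
  refine ⟨DifferentiableOn.div (by fun_prop) (by fun_prop) fun ζ hζ =>
    denom_ne_zero_of_mem_upperHalf hdet hζ, fun ζ hζ => ⟨?_, ?_⟩⟩
  · rw [mem_upperHalf, im_mobius]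
    exact div_pos (mul_pos (mem_upperHalf.1 hζ) hdet) (hd ζ hζ)
  · rw [mem_upperHalf, im_mul_mobius]
    refine div_pos (mul_pos (mem_upperHalf.1 hζ) ?_) (hd ζ hζ)
    rw [mem_upperHalf] at hx hζ
    generalize α * γ = P at *
    generalize α * δ = R at *
    generalize β * δ = S at *
    rw [Complex.normSq_apply] at hQx ⊢
    rcases eq_or_ne P 0 with rfl | hP
    · have hR : R = 0 := by nlinarith
      subst hR
      simpa using hQx
    · have key : ∀ z : ℂ, 0 < z.im →
          0 < P * (P * (z.re * z.re + z.im * z.im) + 2 * R * z.re + S) := fun z hz => by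
        have : 0 < (P * z.im) ^ 2 := by positivity
        nlinarith [sq_nonneg (P * z.re + R)]
      have hP' : 0 < P := pos_of_mul_pos_left (key x hx) hQx.le
      exact pos_of_mul_pos_right (key ζ hζ) hP'.le

end

/-- The extremal case of the interpolation problem, in which `h` is a Möbius transformation. -/
lemma exists_admissible_of_halfDist_eq {x x' y y' : ℂ} (hx : x ∈ upperHalf) (hx' : x' ∈ upperHalf)
    (hy : y ∈ upperHalf) (hy' : y' ∈ upperHalf) (hxy : x * y ∈ upperHalf)
    (hxy' : x' * y' ∈ upperHalf) (hne : x ≠ x') (h : halfDist y y' = halfDist x x')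
    (hle : halfDist (x * y) (x' * y') ≤ halfDist x x') :
    ∃ h, Admissible h ∧ h x = y ∧ h x' = y' := by
  obtain ⟨α, β, γ, δ, hdet, h1, h2⟩ := exists_real_mobius hx hx' hy hy' (by
    rw [halfDist_comm x', halfDist_comm y', h])
  replace h1 : (α * x + β) / (γ * x + δ) = y :=
    ((eq_div_iff (denom_ne_zero_of_mem_upperHalf hdet hx)).2 h1).symm
  replace h2 : (α * x' + β) / (γ * x' + δ) = y' :=
    ((eq_div_iff (denom_ne_zero_of_mem_upperHalf hdet hx')).2 h2).symm
  exact ⟨_, admissible_mobius hdet hx hx' hne (by rwa [h1]) (by rwa [h2]) (by rwa [h1, h2]), h1, h2⟩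

/-- The involution of admissible functions that comes from exchanging the second and the third
coordinate of `{(x, y, z) | x * y * z = -1}`. -/
lemma Admissible.neg_inv {h : ℂ → ℂ} (hh : Admissible h) : Admissible fun ζ => -(ζ * h ζ)⁻¹ := by
  refine ⟨?_, fun ζ hζ => ⟨neg_inv_mem_upperHalf (hh.2 ζ hζ).2, ?_⟩⟩
  · exact ((differentiableOn_id.mul hh.1).inv fun ζ hζ =>
      ne_zero_of_mem_upperHalf (hh.2 ζ hζ).2).neg
  · rw [mul_neg_inv_mul hζ]
    exact neg_inv_mem_upperHalf (hh.2 ζ hζ).1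

lemma exists_admissible_of_max_halfDist_eq {x x' y y' : ℂ} (hx : x ∈ upperHalf)
    (hx' : x' ∈ upperHalf) (hy : y ∈ upperHalf) (hy' : y' ∈ upperHalf) (hxy : x * y ∈ upperHalf)
    (hxy' : x' * y' ∈ upperHalf) (hne : x ≠ x')
    (h : max (halfDist y y') (halfDist (x * y) (x' * y')) = halfDist x x') :
    ∃ h, Admissible h ∧ h x = y ∧ h x' = y' := by
  rcases le_total (halfDist (x * y) (x' * y')) (halfDist y y') with hc | hc
  · rw [max_eq_left hc] at h
    exact exists_admissible_of_halfDist_eq hx hx' hy hy' hxy hxy' hne h (hc.trans h.le)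
  · rw [max_eq_right hc] at h
    obtain ⟨g, hg, h1, h2⟩ := exists_admissible_of_halfDist_eq hx hx' (neg_inv_mem_upperHalf hxy)
      (neg_inv_mem_upperHalf hxy') (by rw [mul_neg_inv_mul hx]; exact neg_inv_mem_upperHalf hy)
      (by rw [mul_neg_inv_mul hx']; exact neg_inv_mem_upperHalf hy') hne
      (by rw [halfDist_neg_inv hxy hxy', h])
      (by rw [mul_neg_inv_mul hx, mul_neg_inv_mul hx', halfDist_neg_inv hy hy']
          exact hc.trans h.le)
    exact ⟨_, hg.neg_inv, by simp only [h1, mul_neg_inv_mul hx, neg_neg, inv_neg, inv_inv],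
      by simp only [h2, mul_neg_inv_mul hx', neg_neg, inv_neg, inv_inv]⟩

lemma smul_mem_upperHalf {t : ℝ} (ht : 0 < t) {z : ℂ} (hz : z ∈ upperHalf) :
    (t : ℂ) * z ∈ upperHalf := by
  rw [mem_upperHalf] at *; simpa using mul_pos ht hz

/-- Shrinking `y'` along its ray raises one of the two distances to that of `x` and `x'`. -/
lemma exists_admissible_shrink {x x' y y' : ℂ} (hx : x ∈ upperHalf)
    (hx' : x' ∈ upperHalf) (hy : y ∈ upperHalf) (hy' : y' ∈ upperHalf) (hxy : x * y ∈ upperHalf)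
    (hxy' : x' * y' ∈ upperHalf) (hne : x ≠ x') (h1 : halfDist y y' ≤ halfDist x x')
    (h2 : halfDist (x * y) (x' * y') ≤ halfDist x x') :
    ∃ t : ℝ, 0 < t ∧ t ≤ 1 ∧ ∃ h, Admissible h ∧ h x = y ∧ h x' = t * y' := by
  have hcont : ∀ u v : ℂ, u ∈ upperHalf → v ∈ upperHalf →
      ContinuousOn (fun t : ℝ => halfDist u (t * v)) (Icc 0 1) := fun u v hu hv => by
    unfold halfDist
    refine ContinuousOn.div (by fun_prop) (by
      refine Continuous.continuousOn (Continuous.norm (continuous_const.sub ?_))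
      exact Complex.continuous_conj.comp (by fun_prop)) fun t ht => ?_
    refine norm_ne_zero_iff.2 (sub_conj_ne_zero hu ?_)
    simpa using mul_nonneg ht.1 (mem_upperHalf.1 hv).le
  have hzero : ∀ u v : ℂ, u ∈ upperHalf → halfDist u ((0 : ℝ) * v) = 1 := fun u v hu => by
    simp [halfDist, ne_zero_of_mem_upperHalf hu]
  have hlt := halfDist_lt_one hx hx'
  have hmax : ContinuousOn
      (fun t : ℝ => max (halfDist y (t * y')) (halfDist (x * y) (t * (x' * y')))) (Icc 0 1) :=
    ContinuousOn.sup (hcont y y' hy hy') (hcont (x * y) (x' * y') hxy hxy')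
  obtain ⟨t, ht, hte⟩ := intermediate_value_Icc' (zero_le_one' ℝ) hmax
    (show halfDist x x' ∈ _ by
      simp only [hzero _ _ hy, hzero _ _ hxy, Complex.ofReal_one, one_mul]
      exact ⟨max_le h1 h2, by simpa using hlt.le⟩)
  have ht0 : 0 < t := by
    refine ht.1.lt_of_ne ?_
    rintro rfl
    simp only [hzero _ _ hy, hzero _ _ hxy, max_self] at hte
    exact hlt.ne' hte
  have hcomm : (t : ℂ) * (x' * y') = x' * (t * y') := by ring
  simp only [hcomm] at hte
  exact ⟨t, ht0, ht.2, exists_admissible_of_max_halfDist_eq hx hx' hy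
    (smul_mem_upperHalf ht0 hy') hxy (by rw [← hcomm]; exact smul_mem_upperHalf ht0 hxy') hne hte⟩

/-- Admissible functions form a convex cone. -/
lemma Admissible.combo {h g : ℂ → ℂ} (hh : Admissible h) (hg : Admissible g) {s t : ℝ}
    (hs : 0 ≤ s) (ht : 0 ≤ t) (hst : 0 < s + t) : Admissible fun ζ => s * h ζ + t * g ζ := by
  have key : ∀ u v : ℂ, u ∈ upperHalf → v ∈ upperHalf → s * u + t * v ∈ upperHalf := by
    intro u v hu hv
    rw [mem_upperHalf] at *
    simp only [Complex.add_im, Complex.im_ofReal_mul]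
    rcases hs.eq_or_lt with rfl | hs
    · simp only [zero_add] at hst; simpa using mul_pos hst hv
    · exact add_pos_of_pos_of_nonneg (mul_pos hs hu) (mul_nonneg ht hv.le)
  refine ⟨(hh.1.const_mul _).add (hg.1.const_mul _), fun ζ hζ =>
    ⟨key _ _ (hh.2 ζ hζ).1 (hg.2 ζ hζ).1, ?_⟩⟩
  rw [show ζ * (s * h ζ + t * g ζ) = s * (ζ * h ζ) + t * (ζ * g ζ) by ring]
  exact key _ _ (hh.2 ζ hζ).2 (hg.2 ζ hζ).2

/-- Two points `(x, y)`, `(x', y')` of `wedge` whose first coordinates are farthest apart lie on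
the graph of an admissible function. -/
theorem exists_admissible {x x' y y' : ℂ} (hx : x ∈ upperHalf)
    (hx' : x' ∈ upperHalf) (hy : y ∈ upperHalf) (hy' : y' ∈ upperHalf) (hxy : x * y ∈ upperHalf)
    (hxy' : x' * y' ∈ upperHalf) (hne : x ≠ x') (h1 : halfDist y y' ≤ halfDist x x')
    (h2 : halfDist (x * y) (x' * y') ≤ halfDist x x') :
    ∃ h, Admissible h ∧ h x = y ∧ h x' = y' := by
  obtain ⟨t, ht0, ht1, h, hh, hx1, hx2⟩ :=
    exists_admissible_shrink hx hx' hy hy' hxy hxy' hne h1 h2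
  obtain ⟨r, hr0, hr1, g, hg, gx2, gx1⟩ :=
    exists_admissible_shrink hx' hx hy' hy hxy' hxy hne.symm
      (by rwa [halfDist_comm y', halfDist_comm x'])
      (by rwa [halfDist_comm (x' * y'), halfDist_comm x'])
  rcases ht1.eq_or_lt with rfl | ht1
  · exact ⟨h, hh, hx1, by simpa using hx2⟩
  -- The weights solve `a + b * r = 1` and `a * t + b = 1`.
  have hd : 0 < 1 - t * r := by nlinarith
  have hd' : (1 : ℂ) - t * r ≠ 0 := by exact_mod_cast hd.ne'
  refine ⟨_, hh.combo hg (s := (1 - r) / (1 - t * r)) (t := (1 - t) / (1 - t * r))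
    (div_nonneg (by linarith) hd.le) (div_nonneg (by linarith) hd.le) ?_, ?_, ?_⟩
  · rw [← add_div]; exact div_pos (by linarith) hd
  · simp only [hx1, gx1]
    push_cast
    rw [div_mul_eq_mul_div, div_mul_eq_mul_div, ← add_div, div_eq_iff hd']
    ring
  · simp only [hx2, gx2]
    push_cast
    rw [div_mul_eq_mul_div, div_mul_eq_mul_div, ← add_div, div_eq_iff hd']
    ring

/-! ### The model domain -/

section Wedge

open Topology Complex

/-- The model of `domainD a b`: the pairs `(x, y)` such that `x`, `y` and `x * y` lie in the upper
half-plane. It is the projection of the points `(x, y, z)` of the threefold product of the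
upper half-plane with `x * y * z = -1`. -/
def wedge : Set (ℂ × ℂ) := {p | p.1 ∈ upperHalf ∧ p.2 ∈ upperHalf ∧ p.1 * p.2 ∈ upperHalf}

lemma isOpen_wedge : IsOpen wedge :=
  (isOpen_upperHalf.preimage continuous_fst).inter
    ((isOpen_upperHalf.preimage continuous_snd).inter
      (isOpen_upperHalf.preimage (continuous_fst.mul continuous_snd)))

lemma convex_upperHalf : Convex ℝ upperHalf := convex_halfSpace_im_gt 0

/-- The fibre of `wedge` over `x` is the open sector spanned by `1` and `-x⁻¹`; so `wedge` is a
continuous image of a convex set. -/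
lemma isConnected_wedge : IsConnected wedge := by
  have himg : wedge = (fun q : ℂ × ℝ × ℝ => (q.1, (q.2.1 : ℂ) - q.2.2 * q.1⁻¹)) ''
      (upperHalf ×ˢ (Ioi (0 : ℝ) ×ˢ Ioi (0 : ℝ))) := by
    ext ⟨x, y⟩
    constructor
    · rintro ⟨hx, hy, hxy⟩
      simp only at hx hy hxy
      have h0 := Complex.normSq_pos.2 (ne_zero_of_mem_upperHalf hx)
      have hx' := (mem_upperHalf.1 hx).ne'
      refine ⟨(x, (x * y).im / x.im, y.im * Complex.normSq x / x.im),
        ⟨hx, mem_Ioi.2 (div_pos hxy hx), mem_Ioi.2 (div_pos (mul_pos hy h0) hx)⟩, ?_⟩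
      simp only [Prod.mk.injEq, true_and]
      apply Complex.ext
      · simp only [Complex.sub_re, Complex.ofReal_re, Complex.re_ofReal_mul, Complex.inv_re]
        rw [Complex.mul_im]
        field_simp
        ring
      · simp only [Complex.sub_im, Complex.ofReal_im, Complex.im_ofReal_mul, Complex.inv_im]
        field_simp
        ring
    · rintro ⟨⟨x', p, q⟩, ⟨hx, hp, hq⟩, h⟩
      simp only [Prod.mk.injEq] at h hx hp hq
      obtain ⟨rfl, rfl⟩ := h
      have h0 := ne_zero_of_mem_upperHalf hx
      have h1 := neg_inv_mem_upperHalf hx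
      rw [mem_Ioi] at hp hq
      refine ⟨hx, ?_, ?_⟩
      · rw [mem_upperHalf] at *
        simp only [Complex.sub_im, Complex.ofReal_im, Complex.im_ofReal_mul, Complex.neg_im] at *
        nlinarith
      · have : x' * ((p : ℂ) - q * x'⁻¹) = p * x' - q := by field_simp
        rw [mem_upperHalf] at *
        simp only [this, Complex.sub_im, Complex.im_ofReal_mul, Complex.ofReal_im, sub_zero]
        exact mul_pos hp hx
  rw [himg]
  refine IsConnected.image ⟨⟨(Complex.I, 1, 1), by simp [upperHalf]⟩, ?_⟩ _ ?_
  · exact convex_upperHalf.isPreconnected.prod (isPreconnected_Ioi.prod isPreconnected_Ioi)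
  · refine continuousOn_fst.prodMk (ContinuousOn.sub (by fun_prop) (ContinuousOn.mul (by fun_prop)
      (continuousOn_fst.inv₀ fun q hq => ne_zero_of_mem_upperHalf hq.1)))

lemma cayley_fst_mem_holoToDisc {e : ℂ} (he : ‖e‖ = 1) (hi : 0 < e.im) :
    (fun p : ℂ × ℂ => cayley e p.1) ∈ holoToDisc wedge :=
  ⟨(differentiableOn_cayley_upperHalf he hi).comp differentiable_fst.differentiableOn
    fun _ hp => hp.1, fun _ hp => cayley_mem_disc he hi hp.1⟩

lemma differentiableOn_graph {e : ℂ} (he : ‖e‖ = 1) (hi : 0 < e.im) {h : ℂ → ℂ}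
    (hh : Admissible h) :
    DifferentiableOn ℂ (fun ζ => (cayley e ζ, h (cayley e ζ))) disc ∧
      MapsTo (fun ζ => (cayley e ζ, h (cayley e ζ))) disc wedge := by
  have hm : MapsTo (cayley e) disc upperHalf := fun z hz => cayley_mem_upperHalf he hi hz
  exact ⟨(differentiableOn_cayley_disc he).prodMk
    (hh.1.comp (differentiableOn_cayley_disc he) hm),
    fun z hz => ⟨hm hz, (hh.2 _ (hm hz)).1, (hh.2 _ (hm hz)).2⟩⟩

/-- The first coordinate of `wedge` is extremal for the pairs of points at which it is the farthest
apart among the three coordinates. -/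
lemma carDist_wedge {e : ℂ} (he : ‖e‖ = 1) (hi : 0 < e.im) {w z : ℂ × ℂ} (hw : w ∈ wedge)
    (hz : z ∈ wedge) (hne : w.1 ≠ z.1) (h1 : halfDist w.2 z.2 ≤ halfDist w.1 z.1)
    (h2 : halfDist (w.1 * w.2) (z.1 * z.2) ≤ halfDist w.1 z.1) :
    carDist wedge w z = ENNReal.ofReal (hypDist (cayley e w.1) (cayley e z.1)) := by
  obtain ⟨h, hh, hw2, hz2⟩ := exists_admissible hw.1 hz.1 hw.2.1 hz.2.1 hw.2.2 hz.2.2 hne h1 h2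
  obtain ⟨hd, hm⟩ := differentiableOn_graph he hi hh
  have := carDist_eq_of_analytic_disc (cayley_fst_mem_holoToDisc he hi) hd hm
    (cayley_mem_disc he hi hw.1) (cayley_mem_disc he hi hz.1)
    (by simp only [cayley_cayley_of_mem_upperHalf he hi hw.1,
      cayley_cayley_of_mem_upperHalf he hi hz.1])
  simpa only [cayley_cayley_of_mem_upperHalf he hi hw.1,
    cayley_cayley_of_mem_upperHalf he hi hz.1, hw2, hz2, Prod.mk.eta] using this

/-- The identity theorem on `wedge`, deduced from the one in one variable since the slices of
`wedge` are convex. -/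
lemma eqOn_wedge_of_eventuallyEq {F G : ℂ × ℂ → ℂ} (hF : DifferentiableOn ℂ F wedge)
    (hG : DifferentiableOn ℂ G wedge) (h : F =ᶠ[𝓝 (4 * I, 1 + I)] G) : EqOn F G wedge := by
  have hopen₁ : ∀ y, IsOpen {x | (x, y) ∈ wedge} := fun y =>
    isOpen_wedge.preimage (Continuous.prodMk_left y)
  have hopen₂ : ∀ x, IsOpen {y | (x, y) ∈ wedge} := fun x =>
    isOpen_wedge.preimage (Continuous.prodMk_right x)
  have hconv₁ : ∀ y, Convex ℝ {x | (x, y) ∈ wedge} := fun y => by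
    intro u hu v hv s t hs ht hst
    obtain ⟨u1, u2, u3⟩ := hu
    obtain ⟨v1, v2, v3⟩ := hv
    refine ⟨convex_upperHalf u1 v1 hs ht hst, u2, ?_⟩
    simpa only [add_mul, smul_mul_assoc] using convex_upperHalf u3 v3 hs ht hst
  have hconv₂ : ∀ x, Convex ℝ {y | (x, y) ∈ wedge} := fun x => by
    intro u hu v hv s t hs ht hst
    obtain ⟨u1, u2, u3⟩ := hu
    obtain ⟨v1, v2, v3⟩ := hv
    refine ⟨u1, convex_upperHalf u2 v2 hs ht hst, ?_⟩
    simpa only [mul_add, mul_smul_comm] using convex_upperHalf u3 v3 hs ht hst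
  have slice₁ : ∀ x₀ y, (x₀, y) ∈ wedge → (∀ᶠ x in 𝓝 x₀, F (x, y) = G (x, y)) →
      ∀ x, (x, y) ∈ wedge → F (x, y) = G (x, y) := by
    intro x₀ y h0 he x hx
    have hd : ∀ {H : ℂ × ℂ → ℂ}, DifferentiableOn ℂ H wedge →
        AnalyticOnNhd ℂ (fun x => H (x, y)) {x | (x, y) ∈ wedge} := fun hH =>
      (hH.comp (f := fun x => (x, y)) (by fun_prop) fun _ hx => hx).analyticOnNhd (hopen₁ y)
    exact (hd hF).eqOn_of_preconnected_of_eventuallyEq (hd hG) (hconv₁ y).isPreconnected h0 he hx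
  have slice₂ : ∀ x y₀, (x, y₀) ∈ wedge → (∀ᶠ y in 𝓝 y₀, F (x, y) = G (x, y)) →
      ∀ y, (x, y) ∈ wedge → F (x, y) = G (x, y) := by
    intro x y₀ h0 he y hy
    have hd : ∀ {H : ℂ × ℂ → ℂ}, DifferentiableOn ℂ H wedge →
        AnalyticOnNhd ℂ (fun y => H (x, y)) {y | (x, y) ∈ wedge} := fun hH =>
      (hH.comp (f := fun y => (x, y)) (by fun_prop) fun _ hy => hy).analyticOnNhd (hopen₂ x)
    exact (hd hF).eqOn_of_preconnected_of_eventuallyEq (hd hG) (hconv₂ x).isPreconnected h0 he hy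
  have h0 : (4 * I, 1 + I) ∈ wedge := by
    refine ⟨?_, ?_, ?_⟩ <;> simp [mem_upperHalf]
  have step₁ : ∀ᶠ x in 𝓝 (4 * I), ∀ y, (x, y) ∈ wedge → F (x, y) = G (x, y) := by
    filter_upwards [h.curry_nhds, (hopen₁ (1 + I)).mem_nhds h0] with x hx hxw
    exact slice₂ x (1 + I) hxw hx
  have step₂ : ∀ x y, (x, y) ∈ wedge → 0 < y.re → F (x, y) = G (x, y) := by
    intro x y hxy hy
    have hw : (4 * I, y) ∈ wedge := ⟨h0.1, hxy.2.1, by simpa [mem_upperHalf] using hy⟩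
    refine slice₁ (4 * I) y hw ?_ x hxy
    filter_upwards [step₁, (hopen₁ y).mem_nhds hw] with x hx hxw using hx y hxw
  rintro ⟨x, y⟩ hxy
  have hx : 0 < x.im := hxy.1
  -- A point `1 + i t` of the fibre over `x`, for small `t > 0`.
  have ht : 0 < x.im / (|x.re| + 1) := by positivity
  have hle : x.im / (|x.re| + 1) * |x.re| < x.im := by
    rw [div_mul_eq_mul_div, div_lt_iff₀ (by positivity)]; nlinarith
  have hw : (x, (⟨1, x.im / (|x.re| + 1)⟩ : ℂ)) ∈ wedge := by
    refine ⟨hx, ht, ?_⟩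
    rw [mem_upperHalf, Complex.mul_im]
    simp only
    nlinarith [neg_abs_le x.re]
  refine slice₂ x _ hw ?_ y hxy
  filter_upwards [(hopen₂ x).mem_nhds hw,
    (isOpen_lt continuous_const Complex.continuous_re).mem_nhds
      (show (0 : ℝ) < (⟨1, x.im / (|x.re| + 1)⟩ : ℂ).re by simp)] with y hy hy0
  exact step₂ x y hy hy0

lemma continuousAt_halfDist {u v : ℂ} (hu : u ∈ upperHalf) (hv : v ∈ upperHalf) :
    ContinuousAt (fun s => halfDist u s) v := by
  refine ContinuousAt.div (by fun_prop) (ContinuousAt.norm (continuousAt_const.sub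
    Complex.continuous_conj.continuousAt)) ?_
  exact norm_ne_zero_iff.2 (sub_conj_ne_zero hu (mem_upperHalf.1 hv).le)

lemma discMob_injOn {u : ℂ} (hu : u ∈ disc) : InjOn (discMob u) disc := fun z hz w hw h => by
  rw [← discMob_neg_discMob hu hz, h, discMob_neg_discMob hu hw]

/-- Every universal set for `wedge` contains the first coordinate, up to automorphisms of the disc.

Let `F` be extremal for two points at which the first coordinate is strictly the farthest
apart. On a complex geodesic through them `F` agrees with an automorphism `φ` of the first
coordinate. Let `w` be one of the points. For `p` near the other one, the distance of `F w` and
`F p` is at most the distance of the first coordinates of `w` and `p`; on the fibres of the first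
coordinate this bound is constant and it is attained on the geodesic, so by the maximum principle
`F` is constant there. -/
theorem containsUpToAut_cayley_fst {C : Set (ℂ × ℂ → ℂ)} (hC : IsUniversalSet wedge C) {e : ℂ}
    (he : ‖e‖ = 1) (hi : 0 < e.im) : ContainsUpToAut wedge C fun p => cayley e p.1 := by
  have hw : ((I, 2 + 2 * I) : ℂ × ℂ) ∈ wedge := by
    refine ⟨?_, ?_, ?_⟩ <;> simp [mem_upperHalf]
  have hz : ((4 * I, 1 + I) : ℂ × ℂ) ∈ wedge := by
    refine ⟨?_, ?_, ?_⟩ <;> simp [mem_upperHalf]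
  have hI : I ∈ upperHalf := hw.1
  have h4I : 4 * I ∈ upperHalf := hz.1
  have hne : I ≠ 4 * I := fun h => by have := congrArg Complex.im h; norm_num at this
  have hlt1 : halfDist (2 + 2 * I) (1 + I) < halfDist I (4 * I) := by
    rw [← not_le, halfDist_le_iff hI h4I hw.2.1 hz.2.1]
    simp [Complex.normSq_apply]; norm_num
  have hlt2 : halfDist (I * (2 + 2 * I)) (4 * I * (1 + I)) < halfDist I (4 * I) := by
    rw [← not_le, halfDist_le_iff hI h4I hw.2.2 hz.2.2]
    simp [Complex.normSq_apply]; norm_num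
  obtain ⟨F, hFC, hF⟩ := hC.2 _ hw _ hz fun h => hne (congrArg Prod.fst h)
  have hFD := hC.1 hFC
  obtain ⟨h, hh, hhw, hhz⟩ :=
    exists_admissible hI h4I hw.2.1 hz.2.1 hw.2.2 hz.2.2 hne hlt1.le hlt2.le
  obtain ⟨hgd, hgm⟩ := differentiableOn_graph he hi hh
  set φ : ℂ → ℂ := fun ζ => F (cayley e ζ, h (cayley e ζ)) with hφ
  have hφF : ∀ ζ ∈ upperHalf, φ (cayley e ζ) = F (ζ, h ζ) := fun ζ hζ => by
    simp only [hφ, cayley_cayley_of_mem_upperHalf he hi hζ]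
  have hφw : φ (cayley e I) = F (I, 2 + 2 * I) := by rw [hφF _ hI, hhw]
  have hcI := cayley_mem_disc he hi hI
  have hc4I := cayley_mem_disc he hi h4I
  have hφb : IsBiholomorphicMap φ disc disc := by
    refine isBiholomorphicMap_of_pseudoDist_eq (hFD.1.comp hgd hgm) (hFD.2.comp hgm) hcI hc4I
      (fun h => hne ?_) ?_
    · have h' := congrArg (cayley e) h
      rwa [cayley_cayley_of_mem_upperHalf he hi hI, cayley_cayley_of_mem_upperHalf he hi h4I] at h'
    · rw [hφw, hφF _ h4I, hhz]
      rw [carDist_wedge he hi hw hz hne hlt1.le hlt2.le] at hF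
      exact le_antisymm
        ((ofReal_hypDist_le_iff (hFD.2 hw) (hFD.2 hz) hcI hc4I).1 hF.ge)
        ((ofReal_hypDist_le_iff hcI hc4I (hFD.2 hw) (hFD.2 hz)).1 hF.le)
  refine ⟨φ, hφb, F, hFC, ?_⟩
  refine eqOn_wedge_of_eventuallyEq hFD.1
    (hφb.1.comp (cayley_fst_mem_holoToDisc he hi).1 (cayley_fst_mem_holoToDisc he hi).2) ?_
  have hc1 : ContinuousAt (fun p : ℂ × ℂ => halfDist I p.1) (4 * I, 1 + I) :=
    ContinuousAt.comp (f := Prod.fst) (g := fun s => halfDist I s)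
      (continuousAt_halfDist hI h4I) continuousAt_fst
  have hc2 : ContinuousAt (fun p : ℂ × ℂ => halfDist (2 + 2 * I) p.2) (4 * I, 1 + I) :=
    (continuousAt_halfDist hw.2.1 hz.2.1).comp (f := Prod.snd) continuousAt_snd
  have hc3 : ContinuousAt (fun p : ℂ × ℂ => halfDist (I * (2 + 2 * I)) (p.1 * p.2))
      (4 * I, 1 + I) :=
    (continuousAt_halfDist hw.2.2 hz.2.2).comp (f := fun p : ℂ × ℂ => p.1 * p.2) (by fun_prop)
  have hev : ∀ᶠ p : ℂ × ℂ in 𝓝 (4 * I, 1 + I), p ∈ wedge ∧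
      pseudoDist (F (I, 2 + 2 * I)) (F p) ≤ halfDist I p.1 := by
    filter_upwards [isOpen_wedge.mem_nhds hz, hc2.eventually_lt hc1 hlt1,
      hc3.eventually_lt hc1 hlt2] with p hp hp1 hp2
    refine ⟨hp, ?_⟩
    have hne' : I ≠ p.1 := fun h => by
      rw [← h, (halfDist_eq_zero hI hI).2 rfl] at hp1
      exact hp1.not_ge (halfDist_nonneg _ _)
    have hle := le_carDist hFD (I, 2 + 2 * I) p
    rw [carDist_wedge he hi hw hp hne' hp1.le hp2.le, ofReal_hypDist_le_iff (hFD.2 hw) (hFD.2 hp)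
      hcI (cayley_mem_disc he hi hp.1), pseudoDist_cayley he hi hI hp.1] at hle
    exact hle
  obtain ⟨ε, hε, hball⟩ := Metric.eventually_nhds_iff_ball.1 hev
  have hcont : ContinuousAt h (4 * I) :=
    (hh.1.differentiableAt (isOpen_upperHalf.mem_nhds h4I)).continuousAt
  have hhε : ∀ᶠ s in 𝓝 (4 * I), h s ∈ Metric.ball (1 + I) ε :=
    hcont.eventually_mem (by rw [hhz]; exact Metric.ball_mem_nhds _ hε)
  have hsε : ∀ᶠ s in 𝓝 (4 * I), s ∈ Metric.ball (4 * I) ε := Metric.ball_mem_nhds _ hε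
  have hyε : ∀ᶠ y in 𝓝 (1 + I), y ∈ Metric.ball (1 + I) ε := Metric.ball_mem_nhds _ hε
  filter_upwards [(hhε.and hsε).prod_nhds hyε]
  rintro ⟨s, y⟩ ⟨⟨hs1, hs2⟩, hy⟩
  simp only at hs1 hs2 hy
  have hslice : ∀ y ∈ Metric.ball (1 + I) ε, (s, y) ∈ wedge ∧
      pseudoDist (F (I, 2 + 2 * I)) (F (s, y)) ≤ halfDist I s := fun y hy =>
    hball (s, y) (by rw [← ball_prod_same]; exact ⟨hs2, hy⟩)
  have hs : s ∈ upperHalf := (hslice y hy).1.1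
  have hFw := hFD.2 hw
  have hFh : pseudoDist (F (I, 2 + 2 * I)) (F (s, h s)) = halfDist I s := by
    rw [← hφw, ← hφF _ hs, hφb.pseudoDist_eq hcI (cayley_mem_disc he hi hs),
      pseudoDist_cayley he hi hI hs]
  have hmax : IsMaxOn (norm ∘ fun y => discMob (F (I, 2 + 2 * I)) (F (s, y)))
      (Metric.ball (1 + I) ε) (h s) := fun y hy => by
    simp only [mem_ofPred_eq, Function.comp_apply, norm_discMob]
    rw [pseudoDist_comm, pseudoDist_comm _ (F (I, _)), hFh]
    exact (hslice y hy).2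
  have hconst := Complex.eqOn_of_isPreconnected_of_isMaxOn_norm
    (convex_ball (1 + I) ε).isPreconnected Metric.isOpen_ball
    ((differentiableOn_discMob hFw).comp
      (hFD.1.comp (f := fun y => (s, y)) (by fun_prop) fun y hy => (hslice y hy).1)
      fun y hy => hFD.2 (hslice y hy).1) hs1 hmax hy
  have := discMob_injOn hFw (hFD.2 (hslice y hy).1) (hFD.2 (hslice _ hs1).1) hconst
  simp only [Function.comp_apply]
  rw [this, hφF s hs]

end Wedge

/-! ### Symmetries of the model domain -/

lemma isBiholomorphicMap_swap : IsBiholomorphicMap Prod.swap wedge wedge := by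
  have hd : DifferentiableOn ℂ (Prod.swap : ℂ × ℂ → ℂ × ℂ) wedge :=
    (differentiable_snd.prodMk differentiable_fst).differentiableOn
  have hm : MapsTo (Prod.swap : ℂ × ℂ → ℂ × ℂ) wedge wedge := fun p hp =>
    ⟨hp.2.1, hp.1, by rw [mul_comm]; exact hp.2.2⟩
  exact ⟨hd, hm, Prod.swap, hd, hm, fun _ _ => Prod.swap_swap _, fun _ _ => Prod.swap_swap _⟩

/-- The cyclic permutation `(z, x, y) ↦ (x, y, z)` of the points with `x * y * z = -1`, in the first
two coordinates. -/
noncomputable def cycle (p : ℂ × ℂ) : ℂ × ℂ := (p.2, -(p.1 * p.2)⁻¹)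

lemma differentiableOn_mul_inv : DifferentiableOn ℂ (fun p : ℂ × ℂ => -(p.1 * p.2)⁻¹) wedge :=
  (DifferentiableOn.inv (by fun_prop) fun _ hp => ne_zero_of_mem_upperHalf hp.2.2).neg

lemma cycle_mem_wedge {p : ℂ × ℂ} (hp : p ∈ wedge) : cycle p ∈ wedge := by
  refine ⟨hp.2.1, neg_inv_mem_upperHalf hp.2.2, ?_⟩
  rw [cycle, mul_comm p.1, mul_neg_inv_mul hp.2.1]
  exact neg_inv_mem_upperHalf hp.1

lemma cycle_cycle_cycle {p : ℂ × ℂ} (hp : p ∈ wedge) : cycle (cycle (cycle p)) = p := by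
  have h1 := ne_zero_of_mem_upperHalf hp.1
  have h2 := ne_zero_of_mem_upperHalf hp.2.1
  ext <;> simp only [cycle] <;> field_simp

lemma isBiholomorphicMap_cycle : IsBiholomorphicMap cycle wedge wedge := by
  have hd : DifferentiableOn ℂ cycle wedge :=
    differentiable_snd.differentiableOn.prodMk differentiableOn_mul_inv
  have hm : MapsTo cycle wedge wedge := fun p hp => cycle_mem_wedge hp
  exact ⟨hd, hm, cycle ∘ cycle, hd.comp hd hm, hm.comp hm, fun p hp => cycle_cycle_cycle hp,
    fun p hp => cycle_cycle_cycle hp⟩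

section Charts
variable {D : Set (ℂ × ℂ)} {k : ℂ × ℂ → ℂ × ℂ} {f : ℂ × ℂ → ℂ} {e : ℂ}

lemma carDist_eq_of_chart (hk : IsBiholomorphicMap k wedge D) (he : ‖e‖ = 1) (hi : 0 < e.im)
    (hf : EqOn (f ∘ k) (fun p => cayley e p.1) wedge) {p q : ℂ × ℂ} (hp : p ∈ wedge)
    (hq : q ∈ wedge) (hne : p ≠ q) (h1 : halfDist p.2 q.2 ≤ halfDist p.1 q.1)
    (h2 : halfDist (p.1 * p.2) (q.1 * q.2) ≤ halfDist p.1 q.1) :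
    carDist D (k p) (k q) = ENNReal.ofReal (hypDist (f (k p)) (f (k q))) := by
  have hne1 : p.1 ≠ q.1 := fun h => by
    rw [(halfDist_eq_zero hp.1 hq.1).2 h] at h1
    exact hne (Prod.ext h ((halfDist_eq_zero hp.2.1 hq.2.1).1 (h1.antisymm (halfDist_nonneg _ _))))
  have hfp := hf hp
  have hfq := hf hq
  simp only [Function.comp_apply] at hfp hfq
  rw [hk.carDist_eq hp hq, carDist_wedge he hi hp hq hne1 h1 h2, hfp, hfq]

lemma containsUpToAut_of_chart (hk : IsBiholomorphicMap k wedge D) (he : ‖e‖ = 1)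
    (hi : 0 < e.im) (hf : EqOn (f ∘ k) (fun p => cayley e p.1) wedge) {C : Set (ℂ × ℂ → ℂ)}
    (hC : IsUniversalSet D C) : ContainsUpToAut D C f :=
  ContainsUpToAut.of_comp hk hf (containsUpToAut_cayley_fst (hC.comp hk) he hi)

end Charts

/-! ### The domain `D_{a,b}` -/

/-- The unimodular numbers `exp (i α)`, `exp (i β)` for the angles `α`, `β` opposite to the sides
`a`, `b` of a triangle with side lengths `a`, `b`, `1`. The third angle `γ` has
`sin γ = sin (α + β)`, and the last three equations are the law of sines. -/
lemma exists_triangle_angles {a b : ℝ} (ha : 0 < a) (hb : 0 < b) (h₁ : a < b + 1) (h₂ : b < a + 1)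
    (h₃ : 1 < a + b) : ∃ (e₁ e₂ : ℂ) (k : ℝ), ‖e₁‖ = 1 ∧ ‖e₂‖ = 1 ∧ 0 < k ∧ e₁.im = a * k ∧
      e₂.im = b * k ∧ (e₁ * e₂).im = k := by
  have hP : 0 < (a ^ 2 - (b - 1) ^ 2) * ((b + 1) ^ 2 - a ^ 2) := by
    refine mul_pos ?_ ?_
    · rw [sq_sub_sq]; exact mul_pos (by linarith) (by linarith)
    · rw [sq_sub_sq]; exact mul_pos (by linarith) (by linarith)
  set r := √((a ^ 2 - (b - 1) ^ 2) * ((b + 1) ^ 2 - a ^ 2)) with hr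
  have hr2 : r ^ 2 = (a ^ 2 - (b - 1) ^ 2) * ((b + 1) ^ 2 - a ^ 2) := Real.sq_sqrt hP.le
  have hr0 : 0 < r := Real.sqrt_pos.2 hP
  have hnorm : ∀ z : ℂ, z.re ^ 2 + z.im ^ 2 = 1 → ‖z‖ = 1 := fun z hz => by
    rw [← sq_eq_sq₀ (norm_nonneg z) zero_le_one, ← Complex.normSq_eq_norm_sq,
      Complex.normSq_apply]
    linarith
  refine ⟨⟨(b ^ 2 + 1 - a ^ 2) / (2 * b), r / (2 * b)⟩,
    ⟨(a ^ 2 + 1 - b ^ 2) / (2 * a), r / (2 * a)⟩, r / (2 * a * b), hnorm _ ?_, hnorm _ ?_,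
    by positivity, ?_, ?_, ?_⟩
  · simp only [div_pow, hr2]; field_simp; ring
  · simp only [div_pow, hr2]; field_simp; ring
  · simp only; field_simp
  · simp only; field_simp
  · simp only [Complex.mul_im]; field_simp; ring

section Triangle
variable {a b k : ℝ} {e₁ e₂ : ℂ}

lemma sq_sub_one_of_norm_eq_one {e : ℂ} (he : ‖e‖ = 1) :
    e ^ 2 - 1 = 2 * Complex.I * e.im * e := by
  have h1 := re_sq_add_im_sq_of_norm_eq_one he
  apply Complex.ext
  · simp [pow_two]; linarith
  · simp [pow_two]; ring

lemma coeff_eq (he₁ : ‖e₁‖ = 1) (he₂ : ‖e₂‖ = 1)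
    (hi₂ : e₂.im = b * k) (hi : (e₁ * e₂).im = k) :
    b * ((e₁ * e₂) ^ 2 - 1) = e₁ * (e₂ ^ 2 - 1) := by
  rw [sq_sub_one_of_norm_eq_one (by rw [norm_mul, he₁, he₂, one_mul]),
    sq_sub_one_of_norm_eq_one he₂, hi, hi₂]
  push_cast
  ring

lemma numer_mul (he₁ : ‖e₁‖ = 1) (he₂ : ‖e₂‖ = 1) (hi₁ : e₁.im = a * k) (hi₂ : e₂.im = b * k)
    (hi : (e₁ * e₂).im = k) (z : ℂ × ℂ) : numer a b z * ((e₁ * e₂) ^ 2 - 1) =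
      (e₁ - z.1) * (e₂ - z.2) - e₁ * e₂ * ((1 - e₁ * z.1) * (1 - e₂ * z.2)) := by
  have hB := coeff_eq he₁ he₂ hi₂ hi
  have hA := coeff_eq he₂ he₁ hi₁ (by rw [mul_comm, hi])
  rw [numer]
  linear_combination z.1 * hA + z.2 * hB

lemma denom_mul (he₁ : ‖e₁‖ = 1) (he₂ : ‖e₂‖ = 1) (hi₁ : e₁.im = a * k) (hi₂ : e₂.im = b * k)
    (hi : (e₁ * e₂).im = k) (z : ℂ × ℂ) : denom a b z * ((e₁ * e₂) ^ 2 - 1) =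
      (1 - e₁ * z.1) * (1 - e₂ * z.2) - e₁ * e₂ * ((e₁ - z.1) * (e₂ - z.2)) := by
  have hB := coeff_eq he₁ he₂ hi₂ hi
  have hA := coeff_eq he₂ he₁ hi₁ (by rw [mul_comm, hi])
  rw [denom]
  linear_combination z.1 * hB + z.2 * hA

/-- The product of the Cayley transforms for the angles of the triangle. -/
noncomputable def triangleMap (e₁ e₂ : ℂ) (p : ℂ × ℂ) : ℂ × ℂ := (cayley e₁ p.1, cayley e₂ p.2)

/-- In the coordinates of `triangleMap`, numerator and denominator are proportional to
`x * y - e₁ * e₂` and `1 - e₁ * e₂ * (x * y)`. -/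
lemma exists_numer_denom_eq (he₁ : ‖e₁‖ = 1) (he₂ : ‖e₂‖ = 1) (hk : 0 < k) (hi₁ : e₁.im = a * k)
    (hi₂ : e₂.im = b * k) (hi : (e₁ * e₂).im = k) {z : ℂ × ℂ} (hz : z ∈ bidisc) :
    ∃ μ : ℂ, μ ≠ 0 ∧ numer a b z = μ * (cayley e₁ z.1 * cayley e₂ z.2 - e₁ * e₂) ∧
      denom a b z = μ * (1 - e₁ * e₂ * (cayley e₁ z.1 * cayley e₂ z.2)) := by
  have h1 := one_sub_mul_ne_zero_of_mem_disc he₁ hz.1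
  have h2 := one_sub_mul_ne_zero_of_mem_disc he₂ hz.2
  have h3 : (e₁ * e₂) ^ 2 - 1 ≠ 0 := by
    have := one_sub_sq_ne_zero (e := e₁ * e₂) (by rw [norm_mul, he₁, he₂, one_mul])
      (by rw [hi]; exact hk)
    intro h
    exact this (by linear_combination -h)
  refine ⟨(1 - e₁ * z.1) * (1 - e₂ * z.2) / ((e₁ * e₂) ^ 2 - 1),
    div_ne_zero (mul_ne_zero h1 h2) h3, ?_, ?_⟩
  · rw [← mul_left_inj' h3, numer_mul he₁ he₂ hi₁ hi₂ hi, cayley, cayley]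
    generalize (e₁ * e₂) ^ 2 - 1 = κ at h3
    field_simp
  · rw [← mul_left_inj' h3, denom_mul he₁ he₂ hi₁ hi₂ hi, cayley, cayley]
    generalize (e₁ * e₂) ^ 2 - 1 = κ at h3
    field_simp

/-- The domain `D_{a,b}` is biholomorphic to `wedge`. -/
lemma isBiholomorphicMap_triangleMap (ha : 0 < a) (hb : 0 < b) (he₁ : ‖e₁‖ = 1) (he₂ : ‖e₂‖ = 1)
    (hk : 0 < k) (hi₁ : e₁.im = a * k) (hi₂ : e₂.im = b * k) (hi : (e₁ * e₂).im = k) :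
    IsBiholomorphicMap (triangleMap e₁ e₂) wedge (domainD a b) := by
  have h1 : 0 < e₁.im := by rw [hi₁]; positivity
  have h2 : 0 < e₂.im := by rw [hi₂]; positivity
  have hE : ‖e₁ * e₂‖ = 1 := by rw [norm_mul, he₁, he₂, one_mul]
  have hiff : ∀ z ∈ bidisc, ‖numer a b z‖ < ‖denom a b z‖ ↔
      cayley e₁ z.1 * cayley e₂ z.2 ∈ upperHalf := fun z hz => by
    obtain ⟨μ, hμ, hn, hd⟩ := exists_numer_denom_eq he₁ he₂ hk hi₁ hi₂ hi hz
    rw [hn, hd, norm_mul, norm_mul, mul_lt_mul_iff_right₀ (norm_pos_iff.2 hμ), norm_sub_rev,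
      norm_sub_lt_norm_one_sub_mul_iff hE (by rwa [hi]), mem_upperHalf]
  refine ⟨?_, fun p hp => ?_, triangleMap e₁ e₂, ?_, fun z hz => ?_, fun p hp => ?_,
    fun z hz => ?_⟩
  · exact ((differentiableOn_cayley_upperHalf he₁ h1).comp differentiable_fst.differentiableOn
      fun p hp => hp.1).prodMk ((differentiableOn_cayley_upperHalf he₂ h2).comp
        differentiable_snd.differentiableOn fun p hp => hp.2.1)
  · have hz : triangleMap e₁ e₂ p ∈ bidisc :=
      ⟨cayley_mem_disc he₁ h1 hp.1, cayley_mem_disc he₂ h2 hp.2.1⟩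
    refine ⟨hz, (hiff _ hz).2 ?_⟩
    simp only [triangleMap, cayley_cayley_of_mem_upperHalf he₁ h1 hp.1,
      cayley_cayley_of_mem_upperHalf he₂ h2 hp.2.1]
    exact hp.2.2
  · exact ((differentiableOn_cayley_disc he₁).comp differentiable_fst.differentiableOn
      fun z hz => hz.1.1).prodMk ((differentiableOn_cayley_disc he₂).comp
        differentiable_snd.differentiableOn fun z hz => hz.1.2)
  · exact ⟨cayley_mem_upperHalf he₁ h1 hz.1.1, cayley_mem_upperHalf he₂ h2 hz.1.2,
      (hiff z hz.1).1 hz.2⟩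
  · simp only [triangleMap, cayley_cayley_of_mem_upperHalf he₁ h1 hp.1,
      cayley_cayley_of_mem_upperHalf he₂ h2 hp.2.1]
  · simp only [triangleMap, cayley_cayley_of_mem_disc he₁ h1 hz.1.1,
      cayley_cayley_of_mem_disc he₂ h2 hz.1.2]

/-- In the coordinates of `triangleMap`, the function `ratFun a b` is the Cayley transform, for the
third angle of the triangle, of the third coordinate `-(x * y)⁻¹`. -/
lemma ratFun_triangleMap (he₁ : ‖e₁‖ = 1) (he₂ : ‖e₂‖ = 1) (hk : 0 < k)
    (ha : 0 < a) (hb : 0 < b) (hi₁ : e₁.im = a * k) (hi₂ : e₂.im = b * k)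
    (hi : (e₁ * e₂).im = k) {p : ℂ × ℂ} (hp : p ∈ wedge) :
    ratFun a b (triangleMap e₁ e₂ p) = cayley (-(e₁ * e₂)⁻¹) (-(p.1 * p.2)⁻¹) := by
  have h1 : 0 < e₁.im := by rw [hi₁]; positivity
  have h2 : 0 < e₂.im := by rw [hi₂]; positivity
  have hE : ‖e₁ * e₂‖ = 1 := by rw [norm_mul, he₁, he₂, one_mul]
  have hE0 : e₁ * e₂ ≠ 0 := by rw [← norm_ne_zero_iff, hE]; exact one_ne_zero
  have hW0 := ne_zero_of_mem_upperHalf hp.2.2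
  obtain ⟨μ, hμ, hn, hd⟩ := exists_numer_denom_eq (z := triangleMap e₁ e₂ p) he₁ he₂ hk hi₁ hi₂ hi
    ⟨cayley_mem_disc he₁ h1 hp.1, cayley_mem_disc he₂ h2 hp.2.1⟩
  rw [ratFun, hn, hd, mul_div_mul_left _ _ hμ]
  simp only [triangleMap, cayley_cayley_of_mem_upperHalf he₁ h1 hp.1,
      cayley_cayley_of_mem_upperHalf he₂ h2 hp.2.1]
  have h4 : 1 - e₁ * e₂ * (p.1 * p.2) ≠ 0 :=
    one_sub_mul_ne_zero_of_mem_upperHalf hE (by rwa [hi]) hp.2.2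
  rw [cayley]
  generalize e₁ * e₂ = E at *
  generalize p.1 * p.2 = W at *
  have h5 : 1 - -E⁻¹ * -W⁻¹ = -(1 - E * W) / (E * W) := by field_simp; ring
  have h6 : -E⁻¹ - -W⁻¹ = -(W - E) / (E * W) := by field_simp; ring
  rw [h5, h6, div_div_div_cancel_right₀ (mul_ne_zero hE0 hW0), neg_div_neg_eq]

end Triangle

lemma isOpen_domainD (a b : ℝ) : IsOpen (domainD a b) := by
  have h1 : Continuous (numer a b) := by unfold numer; fun_prop
  have h2 : Continuous (denom a b) := by unfold denom; fun_prop
  exact (isOpen_disc.prod isOpen_disc).inter (isOpen_lt h1.norm h2.norm)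

lemma ratFun_mem_holoToDisc (a b : ℝ) : ratFun a b ∈ holoToDisc (domainD a b) := by
  have h0 : ∀ z ∈ domainD a b, 0 < ‖denom a b z‖ := fun z hz => (norm_nonneg _).trans_lt hz.2
  refine ⟨?_, fun z hz => ?_⟩
  · have h1 : Differentiable ℂ (numer a b) := by unfold numer; fun_prop
    have h2 : Differentiable ℂ (denom a b) := by unfold denom; fun_prop
    have h3 : ratFun a b = numer a b * (denom a b)⁻¹ := funext fun z => div_eq_mul_inv _ _
    rw [h3]
    exact h1.differentiableOn.mul (h2.differentiableOn.inv fun z hz => norm_pos_iff.1 (h0 z hz))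
  · rw [mem_disc, ratFun, norm_div, div_lt_one (h0 z hz)]
    exact hz.2

lemma encard_pair_le_two {α : Type*} (x y : α) : ({x, y} : Set α).encard ≤ 2 := by
  refine (Set.encard_insert_le _ _).trans ?_
  rw [Set.encard_singleton, one_add_one_eq_two]

/-- If `φ ∘ f = ψ ∘ g` on `D` for automorphisms `φ` and `ψ` of the disc, then `g` is constant on the
fibres of `f`. -/
lemma eq_of_comp_aut_eq {E : Type*} {D : Set E} {F f g : E → ℂ} {φ ψ : ℂ → ℂ}
    (hψ : IsBiholomorphicMap ψ disc disc) (hF : EqOn F (φ ∘ f) D) (hG : EqOn F (ψ ∘ g) D)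
    (hg : MapsTo g D disc) {w z : E} (hw : w ∈ D) (hz : z ∈ D) (h : f w = f z) : g w = g z := by
  obtain ⟨χ, -, hχ, -⟩ := hψ.symm
  have h1 : ψ (g w) = ψ (g z) := by
    have hGw := hG hw
    have hGz := hG hz
    rw [hF hw, Function.comp_apply, h] at hGw
    rw [hF hz, Function.comp_apply] at hGz
    exact hGw.symm.trans hGz
  rw [← hχ (hg hw), h1, hχ (hg hz)]

/-- A domain with the three coordinates of `wedge`, read in the disc, as functions `f₁`, `f₂`, `f₃`:
these functions are universal, and contained up to automorphisms in every universal set. -/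
lemma universal_of_wedge_coordinates {D : Set (ℂ × ℂ)} {Φ : ℂ × ℂ → ℂ × ℂ}
    (hΦ : IsBiholomorphicMap Φ wedge D) {f₁ f₂ f₃ : ℂ × ℂ → ℂ} {e₁ e₂ e₃ : ℂ}
    (he₁ : ‖e₁‖ = 1) (hi₁ : 0 < e₁.im) (he₂ : ‖e₂‖ = 1) (hi₂ : 0 < e₂.im)
    (he₃ : ‖e₃‖ = 1) (hi₃ : 0 < e₃.im)
    (hf₁ : ∀ p ∈ wedge, f₁ (Φ p) = cayley e₁ p.1) (hf₂ : ∀ p ∈ wedge, f₂ (Φ p) = cayley e₂ p.2)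
    (hf₃ : ∀ p ∈ wedge, f₃ (Φ p) = cayley e₃ (-(p.1 * p.2)⁻¹)) (hD₁ : f₁ ∈ holoToDisc D)
    (hD₂ : f₂ ∈ holoToDisc D) (hD₃ : f₃ ∈ holoToDisc D) :
    (∀ C, IsUniversalSet D C →
      ContainsUpToAut D C f₁ ∧ ContainsUpToAut D C f₂ ∧ ContainsUpToAut D C f₃) ∧
      IsUniversalSet D {f₁, f₂, f₃} := by
  have hk₂ := hΦ.comp isBiholomorphicMap_swap
  have hk₃ := hΦ.comp isBiholomorphicMap_cycle
  have hc₁ : EqOn (f₁ ∘ Φ) (fun p => cayley e₁ p.1) wedge := hf₁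
  have hc₂ : EqOn (f₂ ∘ (Φ ∘ Prod.swap)) (fun p => cayley e₂ p.1) wedge := fun p hp =>
    hf₂ _ (isBiholomorphicMap_swap.2.1 hp)
  have hc₃ : EqOn (f₃ ∘ (Φ ∘ cycle)) (fun p => cayley e₃ p.1) wedge := fun p hp => by
    simp only [Function.comp_apply]
    rw [hf₃ _ (cycle_mem_wedge hp)]
    simp only [cycle]
    rw [mul_comm p.1, mul_neg_inv_mul hp.2.1, inv_neg, neg_neg, inv_inv]
  refine ⟨fun C hC => ⟨containsUpToAut_of_chart hΦ he₁ hi₁ hc₁ hC,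
    containsUpToAut_of_chart hk₂ he₂ hi₂ hc₂ hC, containsUpToAut_of_chart hk₃ he₃ hi₃ hc₃ hC⟩,
    by rintro F (rfl | rfl | rfl) <;> assumption, fun w hw z hz hwz => ?_⟩
  obtain ⟨Ψ, hΨ, -, hr⟩ := hΦ.symm
  obtain ⟨p, hp, rfl⟩ : ∃ p ∈ wedge, Φ p = w := ⟨Ψ w, hΨ.2.1 hw, hr hw⟩
  obtain ⟨q, hq, rfl⟩ : ∃ q ∈ wedge, Φ q = z := ⟨Ψ z, hΨ.2.1 hz, hr hz⟩
  have hpq : p ≠ q := fun h => hwz (by rw [h])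
  have case₁ : halfDist p.2 q.2 ≤ halfDist p.1 q.1 →
      halfDist (p.1 * p.2) (q.1 * q.2) ≤ halfDist p.1 q.1 → ∃ F ∈ ({f₁, f₂, f₃} : Set _),
      carDist D (Φ p) (Φ q) = ENNReal.ofReal (hypDist (F (Φ p)) (F (Φ q))) := fun h1 h2 =>
    ⟨f₁, by simp, carDist_eq_of_chart hΦ he₁ hi₁ hc₁ hp hq hpq h1 h2⟩
  have case₂ : halfDist p.1 q.1 ≤ halfDist p.2 q.2 →
      halfDist (p.1 * p.2) (q.1 * q.2) ≤ halfDist p.2 q.2 → ∃ F ∈ ({f₁, f₂, f₃} : Set _),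
      carDist D (Φ p) (Φ q) = ENNReal.ofReal (hypDist (F (Φ p)) (F (Φ q))) := fun h1 h2 =>
    ⟨f₂, by simp, carDist_eq_of_chart (p := p.swap) (q := q.swap) hk₂ he₂ hi₂ hc₂
      (isBiholomorphicMap_swap.2.1 hp) (isBiholomorphicMap_swap.2.1 hq)
      (fun h => hpq (Prod.swap_injective h)) h1
      (by simpa only [Prod.fst_swap, Prod.snd_swap, mul_comm p.2, mul_comm q.2] using h2)⟩
  have case₃ : halfDist p.1 q.1 ≤ halfDist (p.1 * p.2) (q.1 * q.2) →
      halfDist p.2 q.2 ≤ halfDist (p.1 * p.2) (q.1 * q.2) → ∃ F ∈ ({f₁, f₂, f₃} : Set _),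
      carDist D (Φ p) (Φ q) = ENNReal.ofReal (hypDist (F (Φ p)) (F (Φ q))) := fun h1 h2 => by
    have hp' := cycle_mem_wedge (cycle_mem_wedge hp)
    have hq' := cycle_mem_wedge (cycle_mem_wedge hq)
    have key : ∀ {r : ℂ × ℂ}, r ∈ wedge → (cycle (cycle r)).1 = -(r.1 * r.2)⁻¹ ∧
        (cycle (cycle r)).2 = r.1 ∧ (cycle (cycle r)).1 * (cycle (cycle r)).2 = -r.2⁻¹ := by
      intro r hr
      have h2 : (cycle (cycle r)).2 = r.1 := congrArg Prod.fst (cycle_cycle_cycle hr)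
      exact ⟨rfl, h2, by rw [h2, mul_comm]; exact mul_neg_inv_mul hr.1 r.2⟩
    obtain ⟨p1, p2, p3⟩ := key hp
    obtain ⟨q1, q2, q3⟩ := key hq
    have := carDist_eq_of_chart hk₃ he₃ hi₃ hc₃ hp' hq'
      (fun h => hpq (by rw [← cycle_cycle_cycle hp, h, cycle_cycle_cycle hq]))
      (by rw [p1, p2, q1, q2, halfDist_neg_inv hp.2.2 hq.2.2]; exact h1)
      (by rw [p3, q3, p1, q1, halfDist_neg_inv hp.2.2 hq.2.2, halfDist_neg_inv hp.2.1 hq.2.1]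
          exact h2)
    simp only [Function.comp_apply, cycle_cycle_cycle hp, cycle_cycle_cycle hq] at this
    exact ⟨f₃, by simp, this⟩
  rcases le_total (halfDist p.2 q.2) (halfDist p.1 q.1) with h1 | h1
  · rcases le_total (halfDist (p.1 * p.2) (q.1 * q.2)) (halfDist p.1 q.1) with h2 | h2
    · exact case₁ h1 h2
    · exact case₃ h2 (h1.trans h2)
  · rcases le_total (halfDist (p.1 * p.2) (q.1 * q.2)) (halfDist p.2 q.2) with h2 | h2
    · exact case₂ h1 h2
    · exact case₃ (h1.trans h2) h2

/-- No two of the three coordinates of `wedge` are functions of each other, so a set that contains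
them up to automorphisms has at least three elements. -/
lemma three_le_encard_of_containsUpToAut {D : Set (ℂ × ℂ)} {Φ : ℂ × ℂ → ℂ × ℂ}
    (hΦ : IsBiholomorphicMap Φ wedge D) {f₁ f₂ f₃ : ℂ × ℂ → ℂ} {e₁ e₂ e₃ : ℂ}
    (he₂ : ‖e₂‖ = 1) (hi₂ : 0 < e₂.im) (he₃ : ‖e₃‖ = 1) (hi₃ : 0 < e₃.im)
    (hf₁ : ∀ p ∈ wedge, f₁ (Φ p) = cayley e₁ p.1) (hf₂ : ∀ p ∈ wedge, f₂ (Φ p) = cayley e₂ p.2)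
    (hf₃ : ∀ p ∈ wedge, f₃ (Φ p) = cayley e₃ (-(p.1 * p.2)⁻¹))
    (hD₂ : f₂ ∈ holoToDisc D) (hD₃ : f₃ ∈ holoToDisc D) {C : Set (ℂ × ℂ → ℂ)}
    (h₁ : ContainsUpToAut D C f₁) (h₂ : ContainsUpToAut D C f₂) (h₃ : ContainsUpToAut D C f₃) :
    3 ≤ C.encard := by
  obtain ⟨φ₁, -, F₁, hF₁, hE₁⟩ := h₁
  obtain ⟨φ₂, hφ₂, F₂, hF₂, hE₂⟩ := h₂
  obtain ⟨φ₃, hφ₃, F₃, hF₃, hE₃⟩ := h₃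
  have mem : ∀ s t : ℝ, 0 < s → 0 < t →
      ((s * Complex.I, t * (1 + Complex.I)) : ℂ × ℂ) ∈ wedge := fun s t hs ht => by
    refine ⟨?_, ?_, ?_⟩ <;> simp [mem_upperHalf, hs, ht]
  have inj : ∀ {e u v : ℂ}, ‖e‖ = 1 → 0 < e.im → u ∈ upperHalf → v ∈ upperHalf →
      cayley e u = cayley e v → u = v := fun he hi hu hv h => by
    rw [← cayley_cayley_of_mem_upperHalf he hi hu, h, cayley_cayley_of_mem_upperHalf he hi hv]
  have hp := mem 1 1 one_pos one_pos
  have hq := mem 1 2 one_pos two_pos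
  have hr := mem 2 1 two_pos one_pos
  have h12 : F₁ ≠ F₂ := by
    rintro rfl
    have h := eq_of_comp_aut_eq hφ₂ hE₁ hE₂ hD₂.2 (hΦ.2.1 hp) (hΦ.2.1 hq)
      (by rw [hf₁ _ hp, hf₁ _ hq])
    rw [hf₂ _ hp, hf₂ _ hq] at h
    have := congrArg Complex.im (inj he₂ hi₂ hp.2.1 hq.2.1 h)
    norm_num at this
  have h13 : F₁ ≠ F₃ := by
    rintro rfl
    have h := eq_of_comp_aut_eq hφ₃ hE₁ hE₃ hD₃.2 (hΦ.2.1 hp) (hΦ.2.1 hq)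
      (by rw [hf₁ _ hp, hf₁ _ hq])
    rw [hf₃ _ hp, hf₃ _ hq] at h
    have := congrArg Complex.im (inv_injective (neg_injective
      (inj he₃ hi₃ (neg_inv_mem_upperHalf hp.2.2) (neg_inv_mem_upperHalf hq.2.2) h)))
    norm_num at this
  have h23 : F₂ ≠ F₃ := by
    rintro rfl
    have h := eq_of_comp_aut_eq hφ₃ hE₂ hE₃ hD₃.2 (hΦ.2.1 hp) (hΦ.2.1 hr)
      (by rw [hf₂ _ hp, hf₂ _ hr])
    rw [hf₃ _ hp, hf₃ _ hr] at h
    have := congrArg Complex.im (inv_injective (neg_injective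
      (inj he₃ hi₃ (neg_inv_mem_upperHalf hp.2.2) (neg_inv_mem_upperHalf hr.2.2) h)))
    norm_num at this
  have h3 : ({F₁, F₂, F₃} : Set (ℂ × ℂ → ℂ)).encard = 3 :=
    Set.encard_eq_three.2 ⟨F₁, F₂, F₃, h12, h13, h23, rfl⟩
  rw [← h3]
  exact Set.encard_le_encard (by rintro F (rfl | rfl | rfl) <;> assumption)

end CaratheodoryUniversal

open CaratheodoryUniversal in
theorem mainTheorem9 (a b : ℝ) (ha : 0 < a) (hb : 0 < b)
    (h₁ : a < b + 1) (h₂ : b < a + 1) (h₃ : 1 < a + b) :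
    (IsOpen (CaratheodoryUniversal.domainD a b) ∧
      IsConnected (CaratheodoryUniversal.domainD a b)) ∧
    (∀ C : Set (ℂ × ℂ → ℂ),
      CaratheodoryUniversal.IsUniversalSet (CaratheodoryUniversal.domainD a b) C →
        CaratheodoryUniversal.ContainsUpToAut (CaratheodoryUniversal.domainD a b) C
          (fun z => z.1) ∧
        CaratheodoryUniversal.ContainsUpToAut (CaratheodoryUniversal.domainD a b) C
          (fun z => z.2) ∧
        CaratheodoryUniversal.ContainsUpToAut (CaratheodoryUniversal.domainD a b) C
          (CaratheodoryUniversal.ratFun a b)) ∧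
    CaratheodoryUniversal.IsUniversalSet (CaratheodoryUniversal.domainD a b)
      {fun z => z.1, fun z => z.2, CaratheodoryUniversal.ratFun a b} ∧
    ({fun z => z.1, fun z => z.2, CaratheodoryUniversal.ratFun a b} :
      Set (ℂ × ℂ → ℂ)).encard = 3 ∧
    (∀ C : Set (ℂ × ℂ → ℂ),
      CaratheodoryUniversal.IsUniversalSet (CaratheodoryUniversal.domainD a b) C →
        3 ≤ C.encard) ∧
    ¬ ∃ f : ℂ × ℂ → ℂ × ℂ,
      CaratheodoryUniversal.IsBiholomorphicMap f (CaratheodoryUniversal.domainD a b)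
        CaratheodoryUniversal.bidisc := by
  obtain ⟨e₁, e₂, k, he₁, he₂, hk, him₁, him₂, him⟩ := exists_triangle_angles ha hb h₁ h₂ h₃
  have hi₁ : 0 < e₁.im := by rw [him₁]; positivity
  have hi₂ : 0 < e₂.im := by rw [him₂]; positivity
  have he₃ : ‖-(e₁ * e₂)⁻¹‖ = 1 := by rw [norm_neg, norm_inv, norm_mul, he₁, he₂]; simp
  have hi₃ : 0 < (-(e₁ * e₂)⁻¹).im :=
    neg_inv_mem_upperHalf (u := e₁ * e₂) (by rwa [mem_upperHalf, him])
  have hΦ := isBiholomorphicMap_triangleMap ha hb he₁ he₂ hk him₁ him₂ him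
  have hf₁ : ∀ p ∈ wedge, (fun z : ℂ × ℂ => z.1) (triangleMap e₁ e₂ p) = cayley e₁ p.1 :=
    fun _ _ => rfl
  have hf₂ : ∀ p ∈ wedge, (fun z : ℂ × ℂ => z.2) (triangleMap e₁ e₂ p) = cayley e₂ p.2 :=
    fun _ _ => rfl
  have hf₃ : ∀ p ∈ wedge, ratFun a b (triangleMap e₁ e₂ p)
      = cayley (-(e₁ * e₂)⁻¹) (-(p.1 * p.2)⁻¹) :=
    fun _ hp => ratFun_triangleMap he₁ he₂ hk ha hb him₁ him₂ him hp
  have hD₁ : (fun z : ℂ × ℂ => z.1) ∈ holoToDisc (domainD a b) :=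
    ⟨differentiable_fst.differentiableOn, fun _ hz => hz.1.1⟩
  have hD₂ : (fun z : ℂ × ℂ => z.2) ∈ holoToDisc (domainD a b) :=
    ⟨differentiable_snd.differentiableOn, fun _ hz => hz.1.2⟩
  have hD₃ := ratFun_mem_holoToDisc a b
  obtain ⟨hall, huniv⟩ := universal_of_wedge_coordinates hΦ he₁ hi₁ he₂ hi₂ he₃ hi₃ hf₁ hf₂ hf₃
    hD₁ hD₂ hD₃
  have hcard : ∀ C, IsUniversalSet (domainD a b) C → 3 ≤ C.encard := fun C hC =>
    three_le_encard_of_containsUpToAut hΦ he₂ hi₂ he₃ hi₃ hf₁ hf₂ hf₃ hD₂ hD₃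
      (hall C hC).1 (hall C hC).2.1 (hall C hC).2.2
  refine ⟨⟨isOpen_domainD a b, ?_⟩, hall, huniv, le_antisymm ?_ (hcard _ huniv), hcard, ?_⟩
  · obtain ⟨Ψ, hΨ, -, hr⟩ := hΦ.symm
    have himg : triangleMap e₁ e₂ '' wedge = domainD a b :=
      hΦ.2.1.image_subset.antisymm fun z hz => ⟨Ψ z, hΨ.2.1 hz, hr hz⟩
    rw [← himg]
    exact isConnected_wedge.image _ hΦ.1.continuousOn
  · refine (Set.encard_insert_le _ _).trans ?_
    rw [show (3 : ℕ∞) = 2 + 1 by norm_num]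
    exact add_le_add_left (encard_pair_le_two _ _) 1
  · rintro ⟨f, hf⟩
    have h3 := hcard _ (isUniversalSet_bidisc.comp hf)
    have h2 := h3.trans ((Set.encard_image_le _ _).trans (encard_pair_le_two _ _))
    exact absurd h2 (by norm_num)
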